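/- Let $d\ge 2$, let $\Omega\subset\mathbb R^d$ be a bounded polygonal ($d=2$) or polyhedral domain that is the interior of its closure, and let $k\ge1$. Let $\mathcal T_h$ be a partition of $\Omega$ into closed, simply connected polygonal or polyhedral cells $T$ of diameter $h_T$, let $\mathcal E_h$ be the set of its (flat) edges or faces, $\mathcal E_h^0\subset\mathcal E_h$ the set of interior ones, each shared by two cells, and $h=\max_T h_T$. Assume that the partitions are shape regular and quasi-uniform: with fixed constants $\rho,\sigma>0$ and $N\in\mathbb N$, every cell satisfies $|T|\ge\rho h_T^d$ and $h\le\sigma h_T$ and has at most $N$ faces. Let $\kappa$ be a measurable (for example, piecewise constant) field of symmetric matrices on $\Omega$ with $\lambda_1\xi^t\xi\le\xi^t\kappa^{-1}\xi\le\lambda_2\xi^t\xi$ for all $\xi\in\mathbb R^d$, where $\lambda_1,\lambda_2>0$. Let $P_m(T)$ be the polynomials of degree at most $m$ on $T$, and put $$V_h=\{v\in[L^2(\Omega)]^d: v|_T\in[P_k(T)]^d\ \forall T\in\mathcal T_h\},\qquad W_h=\{q\in L^2(\Omega):\textstyle\int_\Omega q=0,\ q|_T\in P_{k-1}(T)\ \forall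 T\in\mathcal T_h\}.$$ On a face $e$ shared by $T_1,T_2$ with outward unit normals $n_1,n_2$, let $\{w\}=\frac12(w|_{T_1}+w|_{T_2})$ and $[\![q]\!]=q|_{T_1}n_1+q|_{T_2}n_2$; on $e\subset\partial\Omega$ with outward unit normal $n$, let $\{w\}=w|_e$ and $[\![q]\!]=q|_e n$. Fix degrees $j_T$ with $k<j_T\le J$. For $v\in V_h$ and $q\in W_h$, the discrete weak gradients $\nabla_wv$ and $\tilde\nabla_wq$ are defined on each cell $T$ as the unique elements of $[P_{j_T}(T)]^{d\times d}$ and $[P_k(T)]^d$ with $$(\nabla_wv,\tau)_T=-(v,\nabla\cdot\tau)_T+\langle\{v\},\tau n\rangle_{\partial T}\quad\forall\tau\in[P_{j_T}(T)]^{d\times d},$$ $$(\tilde\nabla_wq,\varphi)_T=-(q,\nabla\cdot\varphi)_T+\langle\{q\},\varphi\cdot n\rangle_{\partial T}\quad\forall\varphi\in[P_k(T)]^d.$$ Let $b(v,q)=(v,\tilde\nabla_wq)$, $|||v|||^2=\|\nabla_wv\|^2+\|\kappa^{-1/2}v\|^2$, $$|||q|||_1^2=\|\kappa^{1/2}\tilde\nabla_wq\|^2+\sum_{e}h^{-1}\|[\![q]\!]\|_e^2,\qquad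 \|q\|_h^2=\sum_{e}h\,\|[\![q]\!]\|_e^2,$$ where both sums run over $e\in\mathcal E_h$, or both run over $e\in\mathcal E_h^0$ (the assertion is made for each of the two choices). Then there are constants $C_1,C_2>0$, depending only on $d,\Omega,k,J,\lambda_1,\lambda_2,\rho,\sigma,N$ (and hence independent of $h$, the partition, the degrees $j_T$, $\kappa$ and $q$), such that for every $q\in W_h$ the following supremum is finite and $$\sup_{0\ne v\in V_h}\frac{|b(v,q)|}{|||v|||}\ \ge\ C_1h\,|||q|||_1-C_2\|q\|_h .$$ -/

import Mathlib

open scoped MeasureTheory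

namespace CDG

/-- The Euclidean space `ℝ^d`. -/
abbrev Pt (d : ℕ) := EuclideanSpace ℝ (Fin d)

/-- Real polynomials in `d` variables. `P_m` is the set of those with `totalDegree ≤ m`. -/
abbrev Poly (d : ℕ) := MvPolynomial (Fin d) ℝ

/-- The value of a polynomial at a point. -/
noncomputable def ev {d : ℕ} (p : Poly d) (x : Pt d) : ℝ := MvPolynomial.eval (fun a => x a) p

/-- The `(d-1)`-dimensional surface measure in `ℝ^d`: the Hausdorff measure, normalized so that it
is Lebesgue measure on hyperplanes (length for `d = 2`, area for `d = 3`). -/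
noncomputable def surf (d : ℕ) : MeasureTheory.Measure (Pt d) :=
  MeasureTheory.Measure.euclideanHausdorffMeasure (d - 1)

/-- A (closed, bounded, not necessarily convex) polytope: a finite union of convex hulls of finite
sets of points. -/
def IsPolytope {d : ℕ} (S : Set (Pt d)) : Prop :=
  ∃ F : Set (Set (Pt d)), F.Finite ∧ (∀ s ∈ F, s.Finite) ∧ S = ⋃ s ∈ F, convexHull ℝ s

/-- A bounded polygonal (`d = 2`) or polyhedral domain. -/
structure IsPolytopalDomain {d : ℕ} (Ω : Set (Pt d)) : Prop where
  isOpen : IsOpen Ω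
  isConnected : IsConnected Ω
  polytope_closure : IsPolytope (closure Ω)
  interior_closure : interior (closure Ω) = Ω

/-- `n` is the unit outward normal of `T` on the flat set `e ⊆ ∂T`: it is a unit vector, orthogonal
to `e`, and at almost every point of `e` it points out of `T` while `-n` points into `T`. -/
structure IsOutwardNormal {d : ℕ} (T e : Set (Pt d)) (n : Pt d) : Prop where
  norm_eq_one : ‖n‖ = 1
  orthogonal : ∀ w ∈ vectorSpan ℝ e, inner ℝ n w = 0
  outward : ∀ᵐ x ∂((surf d).restrict e), ∀ᶠ t : ℝ in nhdsWithin 0 (Set.Ioi 0),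
    x - t • n ∈ interior T ∧ x + t • n ∉ T

/-- A polygonal (`d = 2`) or polyhedral partition of `Ω`. The cells are closed and simply connected;
the faces (edges if `d = 2`) are flat. A face on `∂Ω` belongs to exactly one cell, every other face
is shared by exactly two cells. -/
structure Mesh (d : ℕ) (Ω : Set (Pt d)) where
  /-- number of cells -/
  numCells : ℕ
  /-- number of faces -/
  numFaces : ℕ
  /-- the cells `T` -/
  cell : Fin numCells → Set (Pt d)
  /-- the faces `e` -/
  face : Fin numFaces → Set (Pt d)
  /-- the unit outward normal of a cell on one of its faces -/
  normal : Fin numCells → Fin numFaces → Pt d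
  cell_polytope : ∀ i, IsPolytope (cell i)
  cell_regular : ∀ i, closure (interior (cell i)) = cell i
  cell_simplyConnected : ∀ i, IsSimplyConnected (cell i)
  cell_cover : ⋃ i, cell i = closure Ω
  cell_disjoint : ∀ i i', i ≠ i' → Disjoint (interior (cell i)) (interior (cell i'))
  face_polytope : ∀ f, IsPolytope (face f)
  face_dim : ∀ f, Module.finrank ℝ (vectorSpan ℝ (face f)) = d - 1
  face_connected : ∀ f, IsConnected (face f)
  face_regular : ∀ f, closure (intrinsicInterior ℝ (face f)) = face f
  face_overlap : ∀ f f', f ≠ f' → surf d (face f ∩ face f') = 0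
  frontier_cell : ∀ i, frontier (cell i) = ⋃ f, ⋃ (_ : face f ⊆ frontier (cell i)), face f
  boundary_face : ∀ f, face f ⊆ frontier Ω → {i | face f ⊆ frontier (cell i)}.ncard = 1
  interior_face : ∀ f, ¬ face f ⊆ frontier Ω → {i | face f ⊆ frontier (cell i)}.ncard = 2
  outward_normal : ∀ i f, face f ⊆ frontier (cell i) →
    IsOutwardNormal (cell i) (face f) (normal i f)

namespace Mesh

variable {d : ℕ} {Ω : Set (Pt d)} (M : Mesh d Ω)

/-- The mesh size `h = max_T h_T`, where `h_T` is the diameter of `T`. -/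
noncomputable def size : ℝ := ⨆ i, Metric.diam (M.cell i)

open Classical in
/-- The faces contained in the boundary of the cell `i`. -/
noncomputable def facesOf (i : Fin M.numCells) : Finset (Fin M.numFaces) :=
  Finset.univ.filter fun f => M.face f ⊆ frontier (M.cell i)

open Classical in
/-- The cells whose boundary contains the face `f` (two for an interior face, one for a boundary
face). -/
noncomputable def cellsOf (f : Fin M.numFaces) : Finset (Fin M.numCells) :=
  Finset.univ.filter fun i => M.face f ⊆ frontier (M.cell i)

open Classical in
/-- The set of interior faces. -/
noncomputable def interiorFaces : Finset (Fin M.numFaces) :=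
  Finset.univ.filter fun f => ¬ M.face f ⊆ frontier Ω

/-- Shape regularity and quasi-uniformity with constants `ρ`, `σ`, `N`: the volume of each cell is
at least `ρ h_T ^ d`, each cell has at most `N` faces, and `h ≤ σ h_T` for each cell. -/
structure IsRegular (ρ σ : ℝ) (N : ℕ) : Prop where
  volume_ge : ∀ i, ρ * Metric.diam (M.cell i) ^ d ≤ MeasureTheory.volume.real (M.cell i)
  card_faces_le : ∀ i, (M.facesOf i).card ≤ N
  quasiUniform : ∀ i, M.size ≤ σ * Metric.diam (M.cell i)

/-! A piecewise polynomial scalar function is given by the family of its restrictions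
`q i = q|_{T_i}`; piecewise polynomial vector and matrix functions likewise, by components. -/

/-- The space `V_h` of vector functions whose components on each cell are in `P_k`. -/
def VSpace (k : ℕ) : Set (Fin M.numCells → Fin d → Poly d) :=
  {v | ∀ i a, (v i a).totalDegree ≤ k}

/-- The space `W_h` of scalar functions which are in `P_{k-1}` on each cell and have mean zero. -/
def WSpace (k : ℕ) : Set (Fin M.numCells → Poly d) :=
  {q | (∀ i, (q i).totalDegree ≤ k - 1) ∧ ∑ i, ∫ x in M.cell i, ev (q i) x = 0}

open Classical in
/-- The average `{q}` on a face: the mean of the two one-sided values on an interior face, the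
one-sided value on a boundary face. -/
noncomputable def avg (q : Fin M.numCells → Poly d) (f : Fin M.numFaces) : Poly d :=
  if M.face f ⊆ frontier Ω then ∑ i ∈ M.cellsOf f, q i
  else MvPolynomial.C (1 / 2) * ∑ i ∈ M.cellsOf f, q i

/-- The (vector-valued) jump `[[q]]` on a face: `q|_{T₁} n₁ + q|_{T₂} n₂` on an interior face,
`q n` on a boundary face. -/
noncomputable def jump (q : Fin M.numCells → Poly d) (f : Fin M.numFaces) (x : Pt d) : Pt d :=
  ∑ i ∈ M.cellsOf f, ev (q i) x • M.normal i f

/-- `G` is the discrete weak gradient `∇_w v`: on each cell `T`, `G` is in `[P_j(T)]^{d×d}` and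
`(G, τ)_T = -(v, ∇·τ)_T + ⟨{v}, τ n⟩_{∂T}` for all `τ` in `[P_j(T)]^{d×d}`, where the divergence is
taken row by row. The degree `j` may depend on the cell. -/
def IsWeakGrad (j : Fin M.numCells → ℕ) (v : Fin M.numCells → Fin d → Poly d)
    (G : Fin M.numCells → Fin d → Fin d → Poly d) : Prop :=
  ∀ i, (∀ a b, (G i a b).totalDegree ≤ j i) ∧
    ∀ τ : Fin d → Fin d → Poly d, (∀ a b, (τ a b).totalDegree ≤ j i) →
      ∫ x in M.cell i, ∑ a, ∑ b, ev (G i a b) x * ev (τ a b) x =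
        -(∫ x in M.cell i, ∑ a, ev (v i a) x * ev (∑ b, MvPolynomial.pderiv b (τ a b)) x) +
        ∑ f ∈ M.facesOf i, ∫ x in M.face f,
          ∑ a, ev (M.avg (fun i' => v i' a) f) x * ∑ b, ev (τ a b) x * M.normal i f b ∂(surf d)

/-- `g` is the discrete weak gradient `∇̃_w q`: on each cell `T`, `g` is in `[P_k(T)]^d` and
`(g, φ)_T = -(q, ∇·φ)_T + ⟨{q}, φ·n⟩_{∂T}` for all `φ` in `[P_k(T)]^d`. -/
def IsWeakGradScalar (k : ℕ) (q : Fin M.numCells → Poly d)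
    (g : Fin M.numCells → Fin d → Poly d) : Prop :=
  ∀ i, (∀ a, (g i a).totalDegree ≤ k) ∧
    ∀ φ : Fin d → Poly d, (∀ a, (φ a).totalDegree ≤ k) →
      ∫ x in M.cell i, ∑ a, ev (g i a) x * ev (φ a) x =
        -(∫ x in M.cell i, ev (q i) x * ev (∑ a, MvPolynomial.pderiv a (φ a)) x) +
        ∑ f ∈ M.facesOf i, ∫ x in M.face f,
          ev (M.avg q f) x * ∑ a, ev (φ a) x * M.normal i f a ∂(surf d)

end Mesh

theorem IsPolytope.isCompact {d : ℕ} {S : Set (Pt d)} (h : IsPolytope S) : IsCompact S := by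
  obtain ⟨F, hF, hs, rfl⟩ := h
  exact hF.isCompact_biUnion fun s hsF => (hs s hsF).isCompact_convexHull (𝕜 := ℝ)

theorem continuous_ev {d : ℕ} (p : Poly d) : Continuous (ev p) := by
  unfold ev
  exact (MvPolynomial.continuous_eval p).comp (by fun_prop)

/-- A bounded flat set has finite surface measure. -/
theorem surf_lt_top {d : ℕ} {e : Set (Pt d)} (he : IsCompact e)
    (hd : Module.finrank ℝ (vectorSpan ℝ e) = d - 1) : surf d e < ⊤ := by
  rcases e.eq_empty_or_nonempty with rfl | ⟨p, hp⟩
  · simp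
  · have hsub : e ⊆ affineSpan ℝ e := subset_affineSpan ℝ e
    let A := affineSpan ℝ e
    have hpA : p ∈ A := hsub hp
    have : Nonempty A := ⟨⟨p, hpA⟩⟩
    have hdim : Module.finrank ℝ A.direction = d - 1 := by
      rw [← hd]; exact congrArg (fun V : Submodule ℝ (Pt d) => Module.finrank ℝ V)
        (direction_affineSpan ℝ e)
    have him : e = Subtype.val '' (Subtype.val ⁻¹' e : Set A) := by
      ext x
      exact ⟨fun hx => ⟨⟨x, hsub hx⟩, hx, rfl⟩, fun ⟨y, hy, hyx⟩ => hyx ▸ hy⟩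
    unfold surf
    rw [him, AffineSubspace.euclideanHausdorffMeasure_coe_image, ← hdim,
      EuclideanGeometry.euclideanHausdorffMeasure_eq (⟨p, hpA⟩ : A)]
    have hc : IsCompact (Subtype.val ⁻¹' e : Set A) := by
      have hcl : IsClosed (A : Set (Pt d)) := A.closed_of_finiteDimensional
      exact hcl.isClosedEmbedding_subtypeVal.isCompact_preimage he
    have hme : MeasurableSet (Subtype.val ⁻¹' e : Set A) := hc.measurableSet
    rw [MeasureTheory.Measure.map_apply
      (IsometryEquiv.vaddConst (⟨p, hpA⟩ : A)).continuous.measurable hme]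
    have : IsCompact ((IsometryEquiv.vaddConst (⟨p, hpA⟩ : A)) ⁻¹' (Subtype.val ⁻¹' e : Set A)) :=
      (IsometryEquiv.vaddConst (⟨p, hpA⟩ : A)).toHomeomorph.isClosedEmbedding.isCompact_preimage hc
    exact this.measure_lt_top

theorem integrableOn_cell {d : ℕ} {T : Set (Pt d)} (hT : IsCompact T) {g : Pt d → ℝ}
    (hg : Continuous g) : MeasureTheory.IntegrableOn g T :=
  hg.continuousOn.integrableOn_compact hT

theorem integrableOn_face {d : ℕ} {e : Set (Pt d)} (he : IsCompact e)
    (hd : Module.finrank ℝ (vectorSpan ℝ e) = d - 1) {g : Pt d → ℝ}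
    (hg : Continuous g) : MeasureTheory.IntegrableOn g e (surf d) := by
  obtain ⟨C, hC⟩ := he.exists_bound_of_continuousOn hg.continuousOn
  refine MeasureTheory.IntegrableOn.of_bound (surf_lt_top he hd) hg.aestronglyMeasurable C ?_
  exact MeasureTheory.ae_restrict_of_forall_mem he.measurableSet hC

/-- A polynomial that vanishes on a nonempty open set is zero. -/
theorem poly_eq_zero_of_open {d : ℕ} (p : Poly d) {U : Set (Pt d)} (hU : IsOpen U)
    (hne : U.Nonempty) (h : ∀ x ∈ U, ev p x = 0) : p = 0 := by
  obtain ⟨x₀, hx₀⟩ := hne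
  have hV : IsOpen ((fun y : Fin d → ℝ => (WithLp.toLp 2 y : Pt d)) ⁻¹' U) :=
    hU.preimage (PiLp.continuous_toLp 2 _)
  obtain ⟨ε, hε, hball⟩ := Metric.isOpen_iff.mp hV (fun a => x₀ a) hx₀
  refine MvPolynomial.funext_set (fun a => Metric.ball (x₀ a) ε) (fun a => ?_) fun y hy => ?_
  · rw [Real.ball_eq_Ioo]
    exact Set.Ioo_infinite (by linarith)
  · have hy' : y ∈ Metric.ball (fun a => x₀ a) ε := by
      rw [ball_pi _ hε]; exact hy
    have := h _ (hball hy')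
    simpa [ev] using this

theorem eq_zero_of_integral {d : ℕ} {T : Set (Pt d)} (hT : IsCompact T)
    (hint : (interior T).Nonempty) (p : Poly d) (h : ∫ x in T, ev p x * ev p x = 0) : p = 0 := by
  refine poly_eq_zero_of_open p isOpen_interior hint fun x hx => ?_
  have hc : Continuous fun x => ev p x * ev p x := (continuous_ev p).mul (continuous_ev p)
  have hae := (MeasureTheory.integral_eq_zero_iff_of_nonneg
    (fun x => mul_self_nonneg (ev p x)) (integrableOn_cell hT hc)).mp h
  have hae' : (fun x => ev p x * ev p x) =ᵐ[MeasureTheory.volume.restrict (interior T)] 0 :=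
    MeasureTheory.ae_restrict_of_ae_restrict_of_subset interior_subset hae
  have := MeasureTheory.Measure.eqOn_open_of_ae_eq hae' isOpen_interior hc.continuousOn
    continuousOn_const hx
  simpa using this

/-- Riesz representation in `P_m(T)`. -/
theorem exists_riesz {d : ℕ} {T : Set (Pt d)} (hT : IsCompact T) (hint : (interior T).Nonempty)
    (m : ℕ) (L : Poly d →ₗ[ℝ] ℝ) :
    ∃ p : Poly d, p.totalDegree ≤ m ∧ ∀ t : Poly d, t.totalDegree ≤ m →
      ∫ x in T, ev p x * ev t x = L t := by
  let P := MvPolynomial.restrictTotalDegree (Fin d) ℝ m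
  have hi : ∀ p t : Poly d, MeasureTheory.IntegrableOn (fun x => ev p x * ev t x) T := fun p t =>
    integrableOn_cell hT ((continuous_ev p).mul (continuous_ev t))
  let B : P →ₗ[ℝ] P →ₗ[ℝ] ℝ := LinearMap.mk₂ ℝ (fun p t => ∫ x in T, ev p.1 x * ev t.1 x)
    (fun p p' t => by
      rw [← MeasureTheory.integral_add (hi _ _) (hi _ _)]
      congr 1; ext x; simp [ev, add_mul])
    (fun c p t => by
      rw [smul_eq_mul, ← MeasureTheory.integral_const_mul]
      congr 1; ext x; simp [ev, mul_assoc])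
    (fun p t t' => by
      rw [← MeasureTheory.integral_add (hi _ _) (hi _ _)]
      congr 1; ext x; simp [ev, mul_add])
    (fun c p t => by
      rw [smul_eq_mul, ← MeasureTheory.integral_const_mul]
      congr 1; ext x; simp [ev, mul_left_comm])
  have hinj : Function.Injective B := by
    rw [← LinearMap.ker_eq_bot, LinearMap.ker_eq_bot']
    intro p hp
    have h0 : ∫ x in T, ev p.1 x * ev p.1 x = 0 := by
      have := LinearMap.congr_fun hp p
      simpa [B] using this
    exact Subtype.ext (eq_zero_of_integral hT hint _ h0)
  have hsurj : Function.Surjective B := by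
    refine (LinearMap.injective_iff_surjective_of_finrank_eq_finrank ?_).mp hinj
    exact (Subspace.dual_finrank_eq).symm
  obtain ⟨p, hp⟩ := hsurj (L.comp P.subtype)
  refine ⟨p.1, (MvPolynomial.mem_restrictTotalDegree _ _ _).mp p.2, fun t ht => ?_⟩
  have := LinearMap.congr_fun hp ⟨t, (MvPolynomial.mem_restrictTotalDegree _ _ _).mpr ht⟩
  simpa [B] using this

namespace Mesh

variable {d : ℕ} {Ω : Set (Pt d)} (M : Mesh d Ω)

theorem isCompact_cell (i : Fin M.numCells) : IsCompact (M.cell i) :=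
  (M.cell_polytope i).isCompact

theorem interior_cell_nonempty (i : Fin M.numCells) : (interior (M.cell i)).Nonempty := by
  rw [← closure_nonempty_iff, M.cell_regular i]
  exact (M.cell_simplyConnected i).nonempty

theorem integrableOn_face {g : Pt d → ℝ} (hg : Continuous g) (f : Fin M.numFaces) :
    MeasureTheory.IntegrableOn g (M.face f) (surf d) :=
  CDG.integrableOn_face (M.face_polytope f).isCompact (M.face_dim f) hg

theorem integrable_cell_mul (i : Fin M.numCells) (p t : Poly d) :
    MeasureTheory.IntegrableOn (fun x => ev p x * ev t x) (M.cell i) :=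
  integrableOn_cell (M.isCompact_cell i) ((continuous_ev p).mul (continuous_ev t))

theorem integrable_face_mul (f : Fin M.numFaces) (p t : Poly d) (c : ℝ) :
    MeasureTheory.IntegrableOn (fun x => ev p x * (ev t x * c)) (M.face f) (surf d) :=
  M.integrableOn_face ((continuous_ev p).mul ((continuous_ev t).mul continuous_const)) f

/-- The functional `t ↦ -(q, ∂_a t)_T + ⟨{q}, t n_a⟩_{∂T}` on polynomials. -/
noncomputable def weakPartial (q : Fin M.numCells → Poly d) (i : Fin M.numCells) (a : Fin d) :
    Poly d →ₗ[ℝ] ℝ where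
  toFun t := -(∫ x in M.cell i, ev (q i) x * ev (MvPolynomial.pderiv a t) x) +
    ∑ f ∈ M.facesOf i, ∫ x in M.face f, ev (M.avg q f) x * (ev t x * M.normal i f a) ∂(surf d)
  map_add' s t := by
    have h1 : ∫ x in M.cell i, ev (q i) x * ev (MvPolynomial.pderiv a (s + t)) x =
        (∫ x in M.cell i, ev (q i) x * ev (MvPolynomial.pderiv a s) x) +
        ∫ x in M.cell i, ev (q i) x * ev (MvPolynomial.pderiv a t) x := by
      rw [← MeasureTheory.integral_add
        (M.integrable_cell_mul i _ _)
        (M.integrable_cell_mul i _ _)]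
      congr 1; ext x; simp [ev, mul_add]
    have h2 : ∀ f, ∫ x in M.face f, ev (M.avg q f) x * (ev (s + t) x * M.normal i f a) ∂(surf d) =
        (∫ x in M.face f, ev (M.avg q f) x * (ev s x * M.normal i f a) ∂(surf d)) +
        ∫ x in M.face f, ev (M.avg q f) x * (ev t x * M.normal i f a) ∂(surf d) := fun f => by
      rw [← MeasureTheory.integral_add
        (M.integrable_face_mul f _ _ _)
        (M.integrable_face_mul f _ _ _)]
      congr 1; ext x; simp [ev, add_mul, mul_add]
    simp only [h1, h2, Finset.sum_add_distrib]
    ring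
  map_smul' c t := by
    have h1 : ∫ x in M.cell i, ev (q i) x * ev (MvPolynomial.pderiv a (c • t)) x =
        c * ∫ x in M.cell i, ev (q i) x * ev (MvPolynomial.pderiv a t) x := by
      rw [← MeasureTheory.integral_const_mul]
      congr 1; ext x; simp [ev, mul_left_comm]
    have h2 : ∀ f, ∫ x in M.face f, ev (M.avg q f) x * (ev (c • t) x * M.normal i f a) ∂(surf d) =
        c * ∫ x in M.face f, ev (M.avg q f) x * (ev t x * M.normal i f a) ∂(surf d) := fun f => by
      rw [← MeasureTheory.integral_const_mul]
      congr 1; ext x; simp only [ev, MvPolynomial.smul_eval]; ring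
    simp only [h1, h2, ← Finset.mul_sum, RingHom.id_apply, smul_eq_mul]
    ring

theorem rhs_scalar_eq (q : Fin M.numCells → Poly d) (i : Fin M.numCells) (φ : Fin d → Poly d) :
    -(∫ x in M.cell i, ev (q i) x * ev (∑ a, MvPolynomial.pderiv a (φ a)) x) +
        ∑ f ∈ M.facesOf i, ∫ x in M.face f,
          ev (M.avg q f) x * ∑ a, ev (φ a) x * M.normal i f a ∂(surf d) =
      ∑ a, M.weakPartial q i a (φ a) := by
  have h1 : ∫ x in M.cell i, ev (q i) x * ev (∑ a, MvPolynomial.pderiv a (φ a)) x =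
      ∑ a, ∫ x in M.cell i, ev (q i) x * ev (MvPolynomial.pderiv a (φ a)) x := by
    rw [← MeasureTheory.integral_finsetSum _ fun a _ =>
      M.integrable_cell_mul i _ _]
    congr 1; ext x; simp [ev, Finset.mul_sum]
  have h2 : ∀ f, ∫ x in M.face f,
      ev (M.avg q f) x * ∑ a, ev (φ a) x * M.normal i f a ∂(surf d) =
      ∑ a, ∫ x in M.face f, ev (M.avg q f) x * (ev (φ a) x * M.normal i f a) ∂(surf d) :=
    fun f => by
    rw [← MeasureTheory.integral_finsetSum _ fun a _ =>
      M.integrable_face_mul f _ _ _]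
    congr 1; ext x; simp [Finset.mul_sum]
  simp only [h1, h2, weakPartial, LinearMap.coe_mk, AddHom.coe_mk, Finset.sum_add_distrib,
    Finset.sum_neg_distrib]
  rw [Finset.sum_comm]

theorem lhs_eq (i : Fin M.numCells) (g φ : Fin d → Poly d) :
    ∫ x in M.cell i, ∑ a, ev (g a) x * ev (φ a) x =
      ∑ a, ∫ x in M.cell i, ev (g a) x * ev (φ a) x :=
  MeasureTheory.integral_finsetSum _ fun _ _ =>
    M.integrable_cell_mul i _ _

/-- The defining property of `∇̃_w q`, component by component. -/
theorem isWeakGradScalar_iff (k : ℕ) (q : Fin M.numCells → Poly d)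
    (g : Fin M.numCells → Fin d → Poly d) :
    M.IsWeakGradScalar k q g ↔ ∀ i a, (g i a).totalDegree ≤ k ∧ ∀ t : Poly d, t.totalDegree ≤ k →
      ∫ x in M.cell i, ev (g i a) x * ev t x = M.weakPartial q i a t := by
  constructor
  · intro h i a
    refine ⟨(h i).1 a, fun t ht => ?_⟩
    have := (h i).2 (Pi.single a t) (fun a' => by
      rcases eq_or_ne a' a with rfl | hne
      · simpa using ht
      · simp [hne])
    rw [rhs_scalar_eq, lhs_eq, Finset.sum_eq_single a, Finset.sum_eq_single a] at this
    · simpa using this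
    · intro b _ hb; simp [hb]
    · simp
    · intro b _ hb; simp [hb, ev]
    · simp
  · intro h i
    refine ⟨fun a => (h i a).1, fun φ hφ => ?_⟩
    rw [rhs_scalar_eq, lhs_eq]
    exact Finset.sum_congr rfl fun a _ => (h i a).2 _ (hφ a)

theorem rhs_vector_eq (v : Fin M.numCells → Fin d → Poly d) (i : Fin M.numCells)
    (τ : Fin d → Fin d → Poly d) :
    -(∫ x in M.cell i, ∑ a, ev (v i a) x * ev (∑ b, MvPolynomial.pderiv b (τ a b)) x) +
        ∑ f ∈ M.facesOf i, ∫ x in M.face f,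
          ∑ a, ev (M.avg (fun i' => v i' a) f) x * ∑ b, ev (τ a b) x * M.normal i f b ∂(surf d) =
      ∑ a, ∑ b, M.weakPartial (fun i' => v i' a) i b (τ a b) := by
  have h2 : ∀ f, ∫ x in M.face f,
      ∑ a, ev (M.avg (fun i' => v i' a) f) x * ∑ b, ev (τ a b) x * M.normal i f b ∂(surf d) =
      ∑ a, ∫ x in M.face f,
        ev (M.avg (fun i' => v i' a) f) x * ∑ b, ev (τ a b) x * M.normal i f b ∂(surf d) :=
    fun f => MeasureTheory.integral_finsetSum _ fun a _ =>
      M.integrableOn_face ((continuous_ev _).mul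
        (continuous_finsetSum _ fun b _ => (continuous_ev _).mul continuous_const)) f
  rw [M.lhs_eq i (v i) fun a => ∑ b, MvPolynomial.pderiv b (τ a b)]
  simp only [h2, ← rhs_scalar_eq, Finset.sum_add_distrib, Finset.sum_neg_distrib]
  rw [Finset.sum_comm]

theorem lhs_matrix_eq (i : Fin M.numCells) (G τ : Fin d → Fin d → Poly d) :
    ∫ x in M.cell i, ∑ a, ∑ b, ev (G a b) x * ev (τ a b) x =
      ∑ a, ∑ b, ∫ x in M.cell i, ev (G a b) x * ev (τ a b) x := by
  simp only [← lhs_eq]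
  exact MeasureTheory.integral_finsetSum _ fun a _ =>
    integrableOn_cell (M.isCompact_cell i)
      (continuous_finsetSum _ fun b _ => (continuous_ev _).mul (continuous_ev _))

/-- The defining property of `∇_w v`, component by component. -/
theorem isWeakGrad_iff (j : Fin M.numCells → ℕ) (v : Fin M.numCells → Fin d → Poly d)
    (G : Fin M.numCells → Fin d → Fin d → Poly d) :
    M.IsWeakGrad j v G ↔ ∀ i a b, (G i a b).totalDegree ≤ j i ∧
      ∀ t : Poly d, t.totalDegree ≤ j i →
        ∫ x in M.cell i, ev (G i a b) x * ev t x = M.weakPartial (fun i' => v i' a) i b t := by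
  constructor
  · intro h i a b
    refine ⟨(h i).1 a b, fun t ht => ?_⟩
    have := (h i).2 (Pi.single a (Pi.single b t)) (fun a' b' => by
      rcases eq_or_ne a' a with rfl | hne
      · rcases eq_or_ne b' b with rfl | hne'
        · simpa using ht
        · simp [hne']
      · simp [hne])
    rw [rhs_vector_eq, lhs_matrix_eq, Finset.sum_eq_single a, Finset.sum_eq_single b,
      Finset.sum_eq_single a, Finset.sum_eq_single b] at this
    · simpa using this
    · intro c _ hc; simp [hc]
    · simp
    · intro c _ hc; simp [hc]
    · simp
    · intro c _ hc; simp [hc, ev]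
    · simp
    · intro c _ hc; simp [hc, ev]
    · simp
  · intro h i
    refine ⟨fun a b => (h i a b).1, fun τ hτ => ?_⟩
    rw [rhs_vector_eq, lhs_matrix_eq]
    exact Finset.sum_congr rfl fun a _ => Finset.sum_congr rfl fun b _ =>
      (h i a b).2 _ (hτ a b)

theorem riesz_unique (i : Fin M.numCells) (m : ℕ) (L : Poly d → ℝ) (p p' : Poly d)
    (hp : p.totalDegree ≤ m ∧ ∀ t : Poly d, t.totalDegree ≤ m →
      ∫ x in M.cell i, ev p x * ev t x = L t)
    (hp' : p'.totalDegree ≤ m ∧ ∀ t : Poly d, t.totalDegree ≤ m →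
      ∫ x in M.cell i, ev p' x * ev t x = L t) : p = p' := by
  have hd : (p - p').totalDegree ≤ m :=
    (MvPolynomial.totalDegree_sub p p').trans (max_le hp.1 hp'.1)
  refine sub_eq_zero.mp (eq_zero_of_integral (M.isCompact_cell i) (M.interior_cell_nonempty i) _ ?_)
  have : ∫ x in M.cell i, ev (p - p') x * ev (p - p') x =
      (∫ x in M.cell i, ev p x * ev (p - p') x) - ∫ x in M.cell i, ev p' x * ev (p - p') x := by
    rw [← MeasureTheory.integral_sub
      (M.integrable_cell_mul i _ _)
      (M.integrable_cell_mul i _ _)]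
    congr 1; ext x; simp only [ev, map_sub]; ring
  rw [this, hp.2 _ hd, hp'.2 _ hd, sub_self]

theorem existsUnique_isWeakGrad (j : Fin M.numCells → ℕ) (v : Fin M.numCells → Fin d → Poly d) :
    ∃! G, M.IsWeakGrad j v G := by
  choose G hG using fun (i : Fin M.numCells) (a b : Fin d) =>
    exists_riesz (M.isCompact_cell i) (M.interior_cell_nonempty i) (j i)
      (M.weakPartial (fun i' => v i' a) i b)
  refine ⟨G, (M.isWeakGrad_iff j v G).mpr hG, fun G' hG' => ?_⟩
  replace hG' := (M.isWeakGrad_iff j v G').mp hG'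
  funext i a b
  exact M.riesz_unique i (j i) _ _ _ (hG' i a b) (hG i a b)

theorem existsUnique_isWeakGradScalar (k : ℕ) (q : Fin M.numCells → Poly d) :
    ∃! g, M.IsWeakGradScalar k q g := by
  choose g hg using fun (i : Fin M.numCells) (a : Fin d) =>
    exists_riesz (M.isCompact_cell i) (M.interior_cell_nonempty i) k (M.weakPartial q i a)
  refine ⟨g, (M.isWeakGradScalar_iff k q g).mpr hg, fun g' hg' => ?_⟩
  replace hg' := (M.isWeakGradScalar_iff k q g').mp hg'
  funext i a
  exact M.riesz_unique i k _ _ _ (hg' i a) (hg i a)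

/-- The discrete weak gradient `∇_w v`; see `existsUnique_isWeakGrad`. -/
noncomputable def weakGrad (j : Fin M.numCells → ℕ) (v : Fin M.numCells → Fin d → Poly d) :
    Fin M.numCells → Fin d → Fin d → Poly d :=
  Classical.epsilon (M.IsWeakGrad j v)

/-- The discrete weak gradient `∇̃_w q`; see `existsUnique_isWeakGradScalar`. -/
noncomputable def weakGradScalar (k : ℕ) (q : Fin M.numCells → Poly d) :
    Fin M.numCells → Fin d → Poly d :=
  Classical.epsilon (M.IsWeakGradScalar k q)

/-- The bilinear form `a(v, w) = (∇_w v, ∇_w w) + (κ⁻¹ v, w)`. -/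
noncomputable def aForm (κ : Pt d → Matrix (Fin d) (Fin d) ℝ) (j : Fin M.numCells → ℕ)
    (v w : Fin M.numCells → Fin d → Poly d) : ℝ :=
  (∑ i, ∫ x in M.cell i, ∑ a, ∑ b, ev (M.weakGrad j v i a b) x * ev (M.weakGrad j w i a b) x) +
  (∑ i, ∫ x in M.cell i,
    dotProduct ((κ x)⁻¹.mulVec fun a => ev (v i a) x) (fun a => ev (w i a) x))

/-- The bilinear form `b(v, q) = (v, ∇̃_w q)`. -/
noncomputable def bForm (k : ℕ) (v : Fin M.numCells → Fin d → Poly d)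
    (q : Fin M.numCells → Poly d) : ℝ :=
  ∑ i, ∫ x in M.cell i, ∑ a, ev (v i a) x * ev (M.weakGradScalar k q i a) x

/-- The norm `|||v||| = a(v, v)^{1/2}`. -/
noncomputable def triNorm (κ : Pt d → Matrix (Fin d) (Fin d) ℝ) (j : Fin M.numCells → ℕ)
    (v : Fin M.numCells → Fin d → Poly d) : ℝ :=
  Real.sqrt (M.aForm κ j v v)

/-- The norm `|||q|||₁ = (‖κ^{1/2} ∇̃_w q‖² + ∑_{e ∈ S} h⁻¹ ‖[[q]]‖_e²)^{1/2}`, the sum being over a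
set `S` of faces. As `κ` is symmetric positive definite, `|κ^{1/2} w|² = w · κ w`. -/
noncomputable def triNormOne (κ : Pt d → Matrix (Fin d) (Fin d) ℝ) (k : ℕ)
    (S : Finset (Fin M.numFaces)) (q : Fin M.numCells → Poly d) : ℝ :=
  Real.sqrt (
    (∑ i, ∫ x in M.cell i, dotProduct (fun a => ev (M.weakGradScalar k q i a) x)
      ((κ x).mulVec fun a => ev (M.weakGradScalar k q i a) x)) +
    (∑ f ∈ S, M.size⁻¹ * ∫ x in M.face f, ‖M.jump q f x‖ ^ 2 ∂(surf d)))

/-- The seminorm `‖q‖_h = (∑_{e ∈ S} h ‖[[q]]‖_e²)^{1/2}`, the sum being over a set `S` of faces. -/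
noncomputable def hNorm (S : Finset (Fin M.numFaces)) (q : Fin M.numCells → Poly d) : ℝ :=
  Real.sqrt (∑ f ∈ S, M.size * ∫ x in M.face f, ‖M.jump q f x‖ ^ 2 ∂(surf d))

end Mesh

/-- `κ` is a permeability tensor on `Ω` with constants `λ₁`, `λ₂`: a measurable field of symmetric
matrices with `λ₁ |ξ|² ≤ ξᵗ κ⁻¹ ξ ≤ λ₂ |ξ|²`. -/
structure IsPermeability {d : ℕ} (Ω : Set (Pt d)) (κ : Pt d → Matrix (Fin d) (Fin d) ℝ)
    (lam₁ lam₂ : ℝ) : Prop where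
  measurable : ∀ a b, Measurable fun x => κ x a b
  isUnit : ∀ x ∈ Ω, IsUnit (κ x)
  isSymm : ∀ x ∈ Ω, (κ x).IsSymm
  lower : ∀ x ∈ Ω, ∀ ξ : Fin d → ℝ, lam₁ * dotProduct ξ ξ ≤ dotProduct ξ ((κ x)⁻¹.mulVec ξ)
  upper : ∀ x ∈ Ω, ∀ ξ : Fin d → ℝ, dotProduct ξ ((κ x)⁻¹.mulVec ξ) ≤ lam₂ * dotProduct ξ ξ

end CDG

/-! The supremum is bounded below by one test function, the weak gradient `g` of `q` itself, whose
components have degree at most `k` and which therefore lies in `V_h`. With this choice b(g, q) =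
‖g‖² (`bForm_self`), so everything rests on the inverse estimate h |||v||| ≤ √C ‖v‖ on `V_h`
(`exists_aForm_le`), which gives b(g, q) / |||g||| ≥ h ‖g‖ / √C. On the other side, κ ≤ λ₁⁻¹ gives h
|||q|||₁ ≤ λ₁^(-1/2) h ‖g‖ + ‖q‖_h (`size_mul_triNormOne_le`), because h times the jump part of
|||q|||₁ is exactly ‖q‖_h. Eliminating ‖g‖ yields the claim.

The inverse estimate must be uniform over cells that may be neither convex nor star-shaped and whose
faces may be arbitrarily small. The tool is a Remez-type bound (`exists_bound_unitBall`): a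
polynomial of bounded degree and its first derivatives are bounded at every point of the unit ball
by the L² norm over any measurable subset of volume at least ρ. This follows by compactness of the
unit sphere of coefficients, since a nonzero polynomial is small only on a set of small measure.
Rescaling gives pointwise bounds on a cell, hence also on its faces, and it remains to know that a
cell has volume at most of order h^d and a flat face area at most of order h^(d-1). Inserting the
weak gradient of v into its own defining identity then bounds it by h⁻¹ times the norms of v on the
cell and its neighbours (`exists_weakPartial_le`, `exists_weakGrad_le`). -/

namespace CDG

open MeasureTheory Metric Set

/-! ### Zero sets of polynomials -/

/-- Fubini and induction on the number of variables: off the null zero set of the leading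
coefficient in variable 0, the slice in that variable is the root set of a nonzero univariate
polynomial, hence finite. -/
theorem volume_zeros_pi_eq_zero : ∀ (n : ℕ) (p : MvPolynomial (Fin n) ℝ), p ≠ 0 →
    volume {y : Fin n → ℝ | MvPolynomial.eval y p = 0} = 0
  | 0, p, hp => by
    have : {y : Fin 0 → ℝ | MvPolynomial.eval y p = 0} = ∅ := by
      refine eq_empty_iff_forall_notMem.mpr fun y hy => hp ?_
      rw [MvPolynomial.eq_C_of_isEmpty p] at hy ⊢
      simpa using hy
    simp [this]
  | n + 1, p, hp => by
    have hclosed : IsClosed {y : Fin (n + 1) → ℝ | MvPolynomial.eval y p = 0} :=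
      isClosed_singleton.preimage (MvPolynomial.continuous_eval p)
    have hmp := (volume_preserving_piFinSuccAbove (fun _ : Fin (n + 1) => ℝ) 0).symm
    rw [← hmp.measure_preimage hclosed.measurableSet.nullMeasurableSet]
    have hms := hmp.measurable hclosed.measurableSet
    -- The swap makes the slices run along variable 0, with the remaining variables fixed.
    rw [Measure.volume_eq_prod, ← Measure.prod_swap, Measure.map_apply measurable_swap hms]
    refine Measure.measure_prod_null_of_ae_null (hms.preimage measurable_swap) ?_
    set P := MvPolynomial.finSuccEquiv ℝ n p with hP
    have hP0 : P ≠ 0 := by simpa [hP] using hp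
    have ih := volume_zeros_pi_eq_zero n P.leadingCoeff (by simpa using hP0)
    have hae : ∀ᵐ y : Fin n → ℝ, MvPolynomial.eval y P.leadingCoeff ≠ 0 := by
      rw [ae_iff]; simpa using ih
    filter_upwards [hae] with y hy
    have hne : P.map (MvPolynomial.eval y) ≠ 0 := fun h0 => hy (by
      have := congrArg (fun Q => Q.coeff P.natDegree) h0
      simpa [Polynomial.coeff_map] using this)
    refine measure_mono_null ?_ ((P.map (MvPolynomial.eval y)).roots.toFinset.finite_toSet
      |>.measure_zero volume)
    intro t ht
    have ht' : MvPolynomial.eval (Fin.cons t y : Fin (n + 1) → ℝ) p = 0 := by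
      simpa [MeasurableEquiv.piFinSuccAbove, Fin.consEquiv] using ht
    rw [MvPolynomial.eval_eq_eval_mv_eval'] at ht'
    simp only [Finset.mem_coe, Multiset.mem_toFinset]
    exact (Polynomial.mem_roots hne).mpr ht'

theorem volume_zeros_eq_zero {d : ℕ} {p : Poly d} (hp : p ≠ 0) :
    volume {x : Pt d | ev p x = 0} = 0 := by
  have hclosed : IsClosed {y : Fin d → ℝ | MvPolynomial.eval y p = 0} :=
    isClosed_singleton.preimage (MvPolynomial.continuous_eval p)
  have := (PiLp.volume_preserving_ofLp (Fin d)).measure_preimage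
    hclosed.measurableSet.nullMeasurableSet
  rw [volume_zeros_pi_eq_zero d p hp] at this
  exact this

/-! ### Affine changes of variables -/

/-- The polynomial `y ↦ p (x + h y)`. -/
noncomputable def rescale {d : ℕ} (x : Pt d) (h : ℝ) : Poly d →ₐ[ℝ] Poly d :=
  MvPolynomial.bind₁ fun a => MvPolynomial.C (x a) + MvPolynomial.C h * MvPolynomial.X a

theorem ev_rescale {d : ℕ} (x : Pt d) (h : ℝ) (p : Poly d) (y : Pt d) :
    ev (rescale x h p) y = ev p (x + h • y) := by
  unfold ev rescale
  induction p using MvPolynomial.induction_on with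
  | C c => simp
  | add p q hp hq => simp [hp, hq]
  | mul_X p a hp => simp [hp]

theorem pderiv_rescale {d : ℕ} (x : Pt d) (h : ℝ) (p : Poly d) (a : Fin d) :
    MvPolynomial.pderiv a (rescale x h p) =
      MvPolynomial.C h * rescale x h (MvPolynomial.pderiv a p) := by
  unfold rescale
  induction p using MvPolynomial.induction_on with
  | C c => simp
  | add p q hp hq => simp [hp, hq, mul_add]
  | mul_X p b hp =>
    rcases eq_or_ne b a with rfl | hab
    · simp [hp, Derivation.leibniz]; ring
    · simp [hp, Derivation.leibniz, MvPolynomial.pderiv_X_of_ne hab]; ring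

theorem totalDegree_rescale_le {d : ℕ} (x : Pt d) (h : ℝ) (p : Poly d) :
    (rescale x h p).totalDegree ≤ p.totalDegree := by
  unfold rescale
  rw [MvPolynomial.bind₁, MvPolynomial.aeval_def, MvPolynomial.eval₂_eq]
  refine MvPolynomial.totalDegree_finsetSum_le fun s hs => ?_
  refine (MvPolynomial.totalDegree_mul _ _).trans ?_
  rw [MvPolynomial.algebraMap_eq, MvPolynomial.totalDegree_C, zero_add]
  refine (MvPolynomial.totalDegree_finsetProd _ _).trans
    (le_trans (Finset.sum_le_sum fun a _ => ?_) (MvPolynomial.le_totalDegree hs))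
  refine (MvPolynomial.totalDegree_pow _ _).trans (mul_le_of_le_one_right' ?_)
  refine (MvPolynomial.totalDegree_add _ _).trans (max_le (by simp) ?_)
  refine (MvPolynomial.totalDegree_mul _ _).trans ?_
  simp

open scoped Pointwise in
theorem setIntegral_rescale {d : ℕ} (x : Pt d) {h : ℝ} (hh : 0 < h) (T : Set (Pt d))
    (f : Pt d → ℝ) :
    ∫ y in T, f y = h ^ d * ∫ y in (fun y => x + h • y) ⁻¹' T, f (x + h • y) := by
  have h1 := (measurePreserving_add_left (volume : Measure (Pt d)) x).setIntegral_preimage_emb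
    (MeasurableEquiv.addLeft x).measurableEmbedding f T
  have h2 := Measure.setIntegral_comp_smul_of_pos (volume : Measure (Pt d))
    (fun z => f (x + z)) ((fun y => x + h • y) ⁻¹' T) hh
  have h3 : h • ((fun y : Pt d => x + h • y) ⁻¹' T) = (fun z => x + z) ⁻¹' T := by
    ext z
    rw [Set.mem_smul_set_iff_inv_smul_mem₀ hh.ne']
    simp [smul_inv_smul₀ hh.ne']
  rw [h3] at h2
  rw [h2, finrank_euclideanSpace_fin, smul_eq_mul, ← mul_assoc, mul_inv_cancel₀ (by positivity),
    one_mul]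
  exact h1.symm

theorem volume_real_rescale {d : ℕ} (x : Pt d) {h : ℝ} (hh : 0 < h) (T : Set (Pt d)) :
    volume.real T = h ^ d * volume.real ((fun y : Pt d => x + h • y) ⁻¹' T) := by
  simpa using setIntegral_rescale x hh T fun _ => (1 : ℝ)

/-! ### Norm equivalence for polynomials of bounded degree -/

/-- The sublevel sets decrease, as the level tends to 0, to the zero set of `p` in the ball, which
is null; their measures are finite, so they tend to 0. -/
theorem exists_sublevel_lt {d : ℕ} {p : Poly d} (hp : p ≠ 0) {δ : ℝ} (hδ : 0 < δ) :
    ∃ ε > 0, volume.real {y ∈ closedBall (0 : Pt d) 1 | |ev p y| ≤ ε} < δ := by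
  have hm : ∀ r : ℝ, MeasurableSet {y ∈ closedBall (0 : Pt d) 1 | |ev p y| ≤ r} := fun r =>
    (isClosed_closedBall.inter
      (isClosed_le (continuous_ev p).abs continuous_const)).measurableSet
  have hfin : ∀ r : ℝ, volume {y ∈ closedBall (0 : Pt d) 1 | |ev p y| ≤ r} ≠ ⊤ := fun r =>
    measure_ne_top_of_subset (fun y hy => hy.1) measure_closedBall_lt_top.ne
  have ht := tendsto_measure_biInter_gt (μ := volume) (a := (0 : ℝ))
    (s := fun r => {y ∈ closedBall (0 : Pt d) 1 | |ev p y| ≤ r})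
    (fun r _ => (hm r).nullMeasurableSet)
    (fun r r' _ hrr' y hy => ⟨hy.1, hy.2.trans hrr'⟩) ⟨1, one_pos, hfin 1⟩
  have h0 : volume (⋂ r > (0 : ℝ), {y ∈ closedBall (0 : Pt d) 1 | |ev p y| ≤ r}) = 0 := by
    refine measure_mono_null (fun y hy => ?_) (volume_zeros_eq_zero hp)
    refine abs_nonpos_iff.mp (le_of_forall_pos_le_add fun r hr => ?_)
    simp only [mem_iInter] at hy
    simpa using (hy r hr).2
  rw [h0] at ht
  have hev := (ht.eventually_lt_const (ENNReal.ofReal_pos.mpr hδ)).and self_mem_nhdsWithin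
  obtain ⟨ε, hε, hε0⟩ := hev.exists
  exact ⟨ε, hε0, (ENNReal.lt_ofReal_iff_toReal_lt (hfin ε)).mp hε⟩

/-- Where |g| > 2ε one has |f| ≥ ε, and the exceptional set takes up at most half of `S`;
Chebyshev's inequality does the rest. Only the volume of `S` enters, which makes the bound uniform
in the shape of `S`. -/
theorem le_setIntegral_sq {d : ℕ} {S : Set (Pt d)}
    (hSB : S ⊆ closedBall 0 1) {f g : Pt d → ℝ} (hf : Continuous f) {ε δ : ℝ} (hε : 0 < ε)
    (hδ : 2 * δ ≤ volume.real S) (hfg : ∀ y ∈ S, |f y - g y| ≤ ε)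
    (hg : volume.real {y ∈ closedBall (0 : Pt d) 1 | |g y| ≤ 2 * ε} ≤ δ) :
    ε ^ 2 * δ ≤ ∫ y in S, f y ^ 2 := by
  have hfin : volume (closedBall (0 : Pt d) 1) ≠ ⊤ := measure_closedBall_lt_top.ne
  have hint : IntegrableOn (fun y => f y ^ 2) S :=
    (integrableOn_cell (isCompact_closedBall 0 1) (hf.pow 2)).mono_set hSB
  have hch := mul_meas_ge_le_integral_of_nonneg (μ := volume.restrict S)
    (Filter.Eventually.of_forall fun y => sq_nonneg (f y)) hint (ε ^ 2)
  refine le_trans (mul_le_mul_of_nonneg_left ?_ (sq_nonneg ε)) hch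
  have hms : MeasurableSet {y | ε ^ 2 ≤ f y ^ 2} :=
    (isClosed_le continuous_const (hf.pow 2)).measurableSet
  rw [measureReal_restrict_apply hms]
  have hsub : S ⊆ ({y | ε ^ 2 ≤ f y ^ 2} ∩ S) ∪
      {y ∈ closedBall (0 : Pt d) 1 | |g y| ≤ 2 * ε} := by
    intro y hy
    by_cases h : ε ^ 2 ≤ f y ^ 2
    · exact Or.inl ⟨h, hy⟩
    · refine Or.inr ⟨hSB hy, ?_⟩
      have h1 : |f y| < ε := abs_lt_of_sq_lt_sq (not_le.mp h) hε.le
      have h2 := abs_sub_abs_le_abs_sub (g y) (f y)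
      rw [abs_sub_comm] at h2
      linarith [hfg y hy]
  have h3 := (measureReal_mono hsub (measure_union_ne_top
    (measure_ne_top_of_subset (fun y hy => hSB hy.2) hfin)
    (measure_ne_top_of_subset (fun y hy => hy.1) hfin))).trans (measureReal_union_le _ _)
  linarith

/-- A Remez-type inequality on the unit ball. -/
theorem exists_bound_unitBall (d m : ℕ) {ρ : ℝ} (hρ : 0 < ρ) :
    ∃ K > 0, ∀ p : Poly d, p.totalDegree ≤ m → ∀ S : Set (Pt d), MeasurableSet S →
      S ⊆ closedBall 0 1 → ρ ≤ volume.real S → ∀ y ∈ closedBall (0 : Pt d) 1,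
        |ev p y| ≤ K * √(∫ z in S, ev p z ^ 2) ∧
        ∀ a, |ev (MvPolynomial.pderiv a p) y| ≤ K * √(∫ z in S, ev p z ^ 2) := by
  obtain ⟨n, r, hinj, hsurj⟩ : ∃ (n : ℕ) (r : (Fin n → ℝ) →ₗ[ℝ] Poly d), Function.Injective r ∧
      ∀ p : Poly d, p.totalDegree ≤ m → ∃ c, r c = p := by
    let P := MvPolynomial.restrictTotalDegree (Fin d) ℝ m
    let b := Module.finBasis ℝ P
    refine ⟨_, P.subtype ∘ₗ b.equivFun.symm.toLinearMap,
      P.subtype_injective.comp b.equivFun.symm.injective, fun p hp => ?_⟩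
    obtain ⟨c, hc⟩ := b.equivFun.symm.surjective
      ⟨p, (MvPolynomial.mem_restrictTotalDegree _ _ _).mpr hp⟩
    exact ⟨c, congrArg Subtype.val hc⟩
  -- continuous functionals are bounded on the unit ball
  have hbound : ∀ D : Poly d →ₗ[ℝ] Poly d, ∃ A > 0, ∀ c, ∀ y ∈ closedBall (0 : Pt d) 1,
      |ev (D (r c)) y| ≤ A * ‖c‖ := by
    intro D
    choose A hA using fun i => (isCompact_closedBall (0 : Pt d) 1).exists_bound_of_continuousOn
      (continuous_ev (D (r fun j => if i = j then 1 else 0))).continuousOn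
    refine ⟨∑ i, |A i| + 1, by positivity, fun c y hy => ?_⟩
    have h1 : ev (D (r c)) y = ∑ i, c i * ev (D (r fun j => if i = j then 1 else 0)) y := by
      rw [r.pi_apply_eq_sum_univ c]
      simp [ev]
    rw [h1, add_mul, Finset.sum_mul]
    refine (Finset.abs_sum_le_sum_abs _ _).trans (le_add_of_le_of_nonneg
      (Finset.sum_le_sum fun i _ => ?_) (by positivity))
    rw [abs_mul, mul_comm]
    exact mul_le_mul ((hA i y hy).trans (le_abs_self _)) (norm_le_pi_norm c i) (abs_nonneg _)
      (abs_nonneg _)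
  obtain ⟨A, hA0, hA⟩ := hbound LinearMap.id
  choose A' hA'0 hA' using fun a : Fin d => hbound (MvPolynomial.pderiv a).toLinearMap
  have hsub : ∀ c c' y, ev (r c) y - ev (r c') y = ev (r (c - c')) y := fun c c' y => by
    simp [ev]
  -- Having a common lower bound `η` passes to subsets and finite unions, so compactness reduces the
  -- claim to a neighbourhood of each point of the sphere.
  have hcompact : ∃ η > 0, ∀ c ∈ sphere (0 : Fin n → ℝ) 1, ∀ S : Set (Pt d), MeasurableSet S →
      S ⊆ closedBall 0 1 → ρ ≤ volume.real S → η ≤ ∫ z in S, ev (r c) z ^ 2 := by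
    refine (isCompact_sphere (0 : Fin n → ℝ) 1).induction_on
      (p := fun s => ∃ η > 0, ∀ c ∈ s, ∀ S : Set (Pt d), MeasurableSet S →
        S ⊆ closedBall 0 1 → ρ ≤ volume.real S → η ≤ ∫ z in S, ev (r c) z ^ 2)
      ⟨1, one_pos, by simp⟩ ?_ ?_ ?_
    · rintro s t hst ⟨η, hη, h⟩
      exact ⟨η, hη, fun c hc => h c (hst hc)⟩
    · rintro s t ⟨η, hη, h⟩ ⟨η', hη', h'⟩
      refine ⟨min η η', lt_min hη hη', ?_⟩
      rintro c (hc | hc) S hS hSB hSρ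
      · exact (min_le_left _ _).trans (h c hc S hS hSB hSρ)
      · exact (min_le_right _ _).trans (h' c hc S hS hSB hSρ)
    · intro c hc
      have hc0 : c ≠ 0 := fun h => by simp [h] at hc
      have hrc : r c ≠ 0 := fun h => hc0 (hinj (by rw [h, map_zero]))
      obtain ⟨ε, hε, hlt⟩ := exists_sublevel_lt hrc (half_pos hρ)
      -- On this ball of coefficients the polynomials differ from `r c` by at most ε/2 on the unit
      -- ball, so the sublevel set of `r c` at level ε = 2 (ε/2) is the one to exclude.
      refine ⟨closedBall c (ε / 2 / A), mem_nhdsWithin_of_mem_nhds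
        (closedBall_mem_nhds c (by positivity)), (ε / 2) ^ 2 * (ρ / 2), by positivity,
        fun c' hc' S hS hSB hSρ => ?_⟩
      refine le_setIntegral_sq hSB (continuous_ev _) (g := ev (r c)) (by positivity)
        (by linarith) (fun y hy => ?_) (by simpa [mul_div_cancel₀] using hlt.le)
      rw [hsub]
      refine (hA _ y (hSB hy)).trans ?_
      rw [mem_closedBall, dist_eq_norm] at hc'
      rw [mul_comm]
      exact (le_div_iff₀ hA0).mp hc'
  obtain ⟨η, hη, hη'⟩ := hcompact
  have hmain : ∀ c, ∀ S : Set (Pt d), MeasurableSet S →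
      S ⊆ closedBall 0 1 → ρ ≤ volume.real S → √η * ‖c‖ ≤ √(∫ z in S, ev (r c) z ^ 2) := by
    intro c S hS hSB hSρ
    rcases eq_or_ne c 0 with rfl | hc
    · simp
    refine Real.le_sqrt_of_sq_le ?_
    -- Homogeneity carries the bound from the unit sphere to every `c`.
    have hn : 0 < ‖c‖ := norm_pos_iff.mpr hc
    have h1 := hη' (‖c‖⁻¹ • c) (by simp [norm_smul, hn.ne']) S hS hSB hSρ
    have h2 : ∀ z, ev (r (‖c‖⁻¹ • c)) z ^ 2 = (‖c‖ ^ 2)⁻¹ * ev (r c) z ^ 2 := fun z => by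
      simp [ev, mul_pow]
    simp only [h2] at h1
    rw [integral_const_mul, ← div_eq_inv_mul, le_div_iff₀ (by positivity)] at h1
    rw [mul_pow, Real.sq_sqrt hη.le]
    exact h1
  refine ⟨(A + ∑ a, A' a) / √η, div_pos (add_pos_of_pos_of_nonneg hA0
    (Finset.sum_nonneg fun a _ => (hA'0 a).le)) (Real.sqrt_pos.mpr hη), ?_⟩
  intro p hp S hS hSB hSρ y hy
  obtain ⟨c, rfl⟩ : ∃ c, r c = p := hsurj p hp
  have hS' := hmain c S hS hSB hSρ
  have key : ∀ B, 0 ≤ B → B ≤ A + ∑ a, A' a → ∀ t, t ≤ B * ‖c‖ →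
      t ≤ (A + ∑ a, A' a) / √η * √(∫ z in S, ev (r c) z ^ 2) := by
    intro B hB hBA t ht
    rw [div_mul_eq_mul_div, le_div_iff₀ (Real.sqrt_pos.mpr hη)]
    calc t * √η ≤ B * ‖c‖ * √η := by gcongr
      _ = B * (√η * ‖c‖) := by ring
      _ ≤ _ := mul_le_mul hBA hS' (by positivity) (hB.trans hBA)
  refine ⟨key A hA0.le (le_add_of_nonneg_right (Finset.sum_nonneg fun a _ => (hA'0 a).le)) _
    (hA c y hy), fun a => key (A' a) (hA'0 a).le ?_ _ (hA' a c y hy)⟩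
  have := Finset.single_le_sum (f := A') (fun a _ => (hA'0 a).le) (Finset.mem_univ a)
  linarith

/-- Inverse inequalities for polynomials on a set of size comparable to `h`. -/
theorem exists_inverse_inequality (d m : ℕ) {ρ : ℝ} (hρ : 0 < ρ) :
    ∃ K > 0, ∀ (h : ℝ) (_ : 0 < h) (x₀ : Pt d) (T : Set (Pt d)), MeasurableSet T →
      T ⊆ closedBall x₀ h → ρ * h ^ d ≤ volume.real T → ∀ p : Poly d, p.totalDegree ≤ m →
      ∀ x ∈ T, √(h ^ d) * |ev p x| ≤ K * √(∫ z in T, ev p z ^ 2) ∧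
        ∀ a, √(h ^ d) * (h * |ev (MvPolynomial.pderiv a p) x|) ≤
          K * √(∫ z in T, ev p z ^ 2) := by
  obtain ⟨K, hK, H⟩ := exists_bound_unitBall d m hρ
  refine ⟨K, hK, fun h hh x₀ T hT hTB hTρ p hp x hx => ?_⟩
  set S := (fun y : Pt d => x₀ + h • y) ⁻¹' T with hS
  have hSm : MeasurableSet S := hT.preimage (by fun_prop)
  have hSB : S ⊆ closedBall 0 1 := fun y hy => by
    have := hTB hy
    rw [mem_closedBall, dist_eq_norm, add_sub_cancel_left, norm_smul, Real.norm_eq_abs,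
      abs_of_pos hh] at this
    rw [mem_closedBall, dist_zero_right]
    exact le_of_mul_le_mul_left (by simpa using this) hh
  have hSρ : ρ ≤ volume.real S := by
    rw [volume_real_rescale x₀ hh T, mul_comm] at hTρ
    exact le_of_mul_le_mul_left hTρ (by positivity)
  have hy : x₀ + h • (h⁻¹ • (x - x₀)) = x := by rw [smul_inv_smul₀ hh.ne']; abel
  have hyS : h⁻¹ • (x - x₀) ∈ S := by rw [hS, mem_preimage, hy]; exact hx
  obtain ⟨h1, h2⟩ := H (rescale x₀ h p) ((totalDegree_rescale_le _ _ _).trans hp) S hSm hSB hSρ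
    _ (hSB hyS)
  have hsq : √(∫ z in T, ev p z ^ 2) = √(h ^ d) * √(∫ z in S, ev (rescale x₀ h p) z ^ 2) := by
    rw [setIntegral_rescale x₀ hh T, Real.sqrt_mul (by positivity)]
    simp only [ev_rescale, hS]
  rw [hsq, mul_left_comm]
  rw [ev_rescale, hy] at h1
  refine ⟨mul_le_mul_of_nonneg_left h1 (Real.sqrt_nonneg _), fun a =>
    mul_le_mul_of_nonneg_left ?_ (Real.sqrt_nonneg _)⟩
  have h3 := h2 a
  -- By the chain rule each derivative of the rescaled polynomial carries a factor `h`.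
  have h4 : ev (MvPolynomial.pderiv a (rescale x₀ h p)) (h⁻¹ • (x - x₀)) =
      h * ev (MvPolynomial.pderiv a p) x := by
    rw [pderiv_rescale]
    conv_rhs => rw [← hy, ← ev_rescale]
    simp [ev]
  rwa [h4, abs_mul, abs_of_pos hh] at h3

/-! ### Volumes of cells and areas of faces -/

/-- A flat face spans an affine subspace of dimension d - 1, on which the surface measure is
Lebesgue measure, and it lies in a ball of radius `h` of that subspace about any of its points. -/
theorem exists_surf_le {d : ℕ} (hd : 2 ≤ d) :
    ∃ ω > 0, ∀ (e : Set (Pt d)) (h : ℝ), 0 ≤ h → IsCompact e →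
      Module.finrank ℝ (vectorSpan ℝ e) = d - 1 → (∀ x ∈ e, ∀ y ∈ e, dist x y ≤ h) →
      (surf d).real e ≤ ω * h ^ (d - 1) := by
  -- The second entry is the volume of the unit ball in dimension d - 1; the maximum with 1 makes
  -- positivity immediate.
  refine ⟨max 1 (√Real.pi ^ (d - 1) / Real.Gamma ((d - 1 : ℕ) / 2 + 1)),
    by positivity, fun e h hh he hdim hdist => ?_⟩
  rcases e.eq_empty_or_nonempty with rfl | ⟨p, hp⟩
  · simp; positivity
  have hsub : e ⊆ affineSpan ℝ e := subset_affineSpan ℝ e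
  let A := affineSpan ℝ e
  have hpA : p ∈ A := hsub hp
  have : Nonempty A := ⟨⟨p, hpA⟩⟩
  have hdim' : Module.finrank ℝ A.direction = d - 1 := by
    rw [← hdim]; exact congrArg (fun V : Submodule ℝ (Pt d) => Module.finrank ℝ V)
      (direction_affineSpan ℝ e)
  have him : e = Subtype.val '' (Subtype.val ⁻¹' e : Set A) := by
    ext x
    exact ⟨fun hx => ⟨⟨x, hsub hx⟩, hx, rfl⟩, fun ⟨y, hy, hyx⟩ => hyx ▸ hy⟩
  have hme : MeasurableSet (Subtype.val ⁻¹' e : Set A) :=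
    he.measurableSet.preimage measurable_subtype_coe
  have : Nontrivial A.direction := Module.nontrivial_of_finrank_pos (R := ℝ) (by omega)
  let φ := IsometryEquiv.vaddConst (⟨p, hpA⟩ : A)
  have h1 : surf d e = volume (φ ⁻¹' (Subtype.val ⁻¹' e)) := by
    unfold surf
    conv_lhs => rw [him]
    rw [AffineSubspace.euclideanHausdorffMeasure_coe_image, ← hdim',
      EuclideanGeometry.euclideanHausdorffMeasure_eq (⟨p, hpA⟩ : A),
      Measure.map_apply φ.continuous.measurable hme]
  have h2 : φ ⁻¹' (Subtype.val ⁻¹' e) ⊆ closedBall 0 h := by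
    intro w hw
    rw [mem_closedBall, ← φ.isometry.dist_eq]
    have := hdist _ hw p hp
    simpa [φ, Subtype.dist_eq] using this
  have h3 := (measure_mono h2).trans_eq (InnerProductSpace.volume_closedBall (0 : A.direction) h)
  rw [measureReal_def, h1]
  refine (ENNReal.toReal_mono (by finiteness) h3).trans ?_
  rw [ENNReal.toReal_mul, ENNReal.toReal_pow, ENNReal.toReal_ofReal hh,
    ENNReal.toReal_ofReal (by positivity), hdim', mul_comm]
  gcongr
  exact le_max_right _ _

theorem volume_real_le {d : ℕ} {T : Set (Pt d)} {x : Pt d} {h : ℝ} (hh : 0 ≤ h)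
    (hT : T ⊆ closedBall x h) :
    volume.real T ≤ volume.real (closedBall (0 : Pt d) 1) * h ^ d := by
  refine (measureReal_mono hT measure_closedBall_lt_top.ne).trans_eq ?_
  rw [measureReal_def, measureReal_def, Measure.addHaar_closedBall' _ _ hh, ENNReal.toReal_mul,
    ENNReal.toReal_ofReal (by positivity), finrank_euclideanSpace_fin, mul_comm]

theorem volume_eq_zero_of_flat {d : ℕ} (hd : 2 ≤ d) {e : Set (Pt d)}
    (h : Module.finrank ℝ (vectorSpan ℝ e) = d - 1) : volume e = 0 := by
  refine measure_mono_null (subset_affineSpan ℝ e) (Measure.addHaar_affineSubspace _ _ ?_)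
  intro htop
  have h1 : Module.finrank ℝ (affineSpan ℝ e).direction =
      Module.finrank ℝ (⊤ : AffineSubspace ℝ (Pt d)).direction := by rw [htop]
  rw [direction_affineSpan, h, AffineSubspace.direction_top, finrank_top,
    finrank_euclideanSpace_fin] at h1
  omega

/-! ### Geometry of the cells and faces of a mesh -/

namespace Mesh

variable {d : ℕ} {Ω : Set (Pt d)} (M : Mesh d Ω)

theorem diam_cell_le_size (i : Fin M.numCells) : diam (M.cell i) ≤ M.size :=
  le_ciSup (f := fun i => diam (M.cell i)) (Set.finite_range _).bddAbove i

theorem diam_cell_pos (hd : 2 ≤ d) (i : Fin M.numCells) : 0 < diam (M.cell i) := by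
  have : Nonempty (Fin d) := ⟨⟨0, by omega⟩⟩
  refine diam_pos ?_ (M.isCompact_cell i).isBounded
  by_contra h
  rw [Set.not_nontrivial_iff] at h
  obtain ⟨x, hx⟩ := M.interior_cell_nonempty i
  rw [h.eq_singleton_of_mem (interior_subset hx), interior_singleton] at hx
  exact hx

theorem nonempty_cells (hΩ : IsPolytopalDomain Ω) : Nonempty (Fin M.numCells) := by
  obtain ⟨x, hx⟩ := hΩ.isConnected.nonempty
  have := M.cell_cover.symm ▸ subset_closure hx
  obtain ⟨i, -⟩ := mem_iUnion.mp this
  exact ⟨i⟩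

theorem size_pos (hd : 2 ≤ d) (i : Fin M.numCells) : 0 < M.size :=
  (M.diam_cell_pos hd i).trans_le (M.diam_cell_le_size i)

theorem dist_le_size {i : Fin M.numCells} {x y : Pt d} (hx : x ∈ M.cell i) (hy : y ∈ M.cell i) :
    dist x y ≤ M.size :=
  (dist_le_diam_of_mem (M.isCompact_cell i).isBounded hx hy).trans (M.diam_cell_le_size i)

theorem cell_subset_closedBall {i : Fin M.numCells} {x : Pt d} (hx : x ∈ M.cell i) :
    M.cell i ⊆ closedBall x M.size :=
  fun _ hy => M.dist_le_size hy hx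

theorem size_le_diam (hΩ : IsPolytopalDomain Ω) : M.size ≤ diam (closure Ω) := by
  have := M.nonempty_cells hΩ
  refine ciSup_le fun i => diam_mono ?_ hΩ.polytope_closure.isCompact.isBounded
  exact (subset_iUnion M.cell i).trans_eq M.cell_cover

/-- Quasi-uniformity trades the diameter of the cell for the mesh size, at the cost of a factor σ^d.
-/
theorem volume_cell_ge {ρ σ : ℝ} {N : ℕ} (hσ : 0 < σ) (hρ : 0 < ρ) (hM : M.IsRegular ρ σ N)
    (hd : 2 ≤ d) (i : Fin M.numCells) : ρ / σ ^ d * M.size ^ d ≤ volume.real (M.cell i) := by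
  refine le_trans ?_ (hM.volume_ge i)
  rw [div_mul_eq_mul_div, div_le_iff₀ (by positivity), mul_assoc, ← mul_pow, mul_comm _ σ]
  gcongr
  · exact (M.size_pos hd i).le
  · exact hM.quasiUniform i

theorem mem_facesOf {i : Fin M.numCells} {f : Fin M.numFaces} :
    f ∈ M.facesOf i ↔ M.face f ⊆ frontier (M.cell i) := by
  classical
  simp [facesOf]

theorem mem_cellsOf {i : Fin M.numCells} {f : Fin M.numFaces} :
    i ∈ M.cellsOf f ↔ M.face f ⊆ frontier (M.cell i) := by
  classical
  simp [cellsOf]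

theorem card_cellsOf_le (f : Fin M.numFaces) : (M.cellsOf f).card ≤ 2 := by
  have h : (M.cellsOf f).card = {i | M.face f ⊆ frontier (M.cell i)}.ncard := by
    rw [← Set.ncard_coe_finset]
    congr 1; ext i; simp [mem_cellsOf]
  by_cases hf : M.face f ⊆ frontier Ω
  · rw [h, M.boundary_face f hf]; norm_num
  · rw [h, M.interior_face f hf]

theorem face_subset_cell {i : Fin M.numCells} {f : Fin M.numFaces}
    (h : M.face f ⊆ frontier (M.cell i)) : M.face f ⊆ M.cell i :=
  h.trans (M.isCompact_cell i).isClosed.frontier_subset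

theorem abs_normal_le {i : Fin M.numCells} {f : Fin M.numFaces}
    (h : M.face f ⊆ frontier (M.cell i)) (a : Fin d) : |M.normal i f a| ≤ 1 := by
  rw [← (M.outward_normal i f h).norm_eq_one]
  exact PiLp.norm_apply_le (M.normal i f) a

/-- The factor 1/2 is given away so that interior and boundary faces obey the same bound. -/
theorem abs_ev_avg_le (q : Fin M.numCells → Poly d) (f : Fin M.numFaces) (x : Pt d) :
    |ev (M.avg q f) x| ≤ ∑ i ∈ M.cellsOf f, |ev (q i) x| := by
  have h := Finset.abs_sum_le_sum_abs (fun i => ev (q i) x) (M.cellsOf f)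
  have h0 : ev (∑ i ∈ M.cellsOf f, q i) x = ∑ i ∈ M.cellsOf f, ev (q i) x := by simp [ev]
  unfold avg
  split_ifs with hf
  · rwa [h0]
  · have : ev (MvPolynomial.C (1 / 2) * ∑ i ∈ M.cellsOf f, q i) x =
        1 / 2 * ∑ i ∈ M.cellsOf f, ev (q i) x := by rw [← h0]; simp [ev]
    rw [this, abs_mul, abs_of_pos (by norm_num : (0 : ℝ) < 1 / 2)]
    linarith [abs_nonneg (∑ i ∈ M.cellsOf f, ev (q i) x)]

/-- The bounds on κ hold only in Ω, whereas cells are closed. The interior of a cell lies in Ω, and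
its frontier is a finite union of flat faces, hence null. -/
theorem ae_mem_domain (hd : 2 ≤ d) (hΩ : IsPolytopalDomain Ω) (i : Fin M.numCells) :
    ∀ᵐ x ∂volume.restrict (M.cell i), x ∈ Ω := by
  have h0 : volume (frontier (M.cell i)) = 0 := by
    rw [M.frontier_cell i]
    exact measure_iUnion_null fun f => measure_iUnion_null fun _ =>
      volume_eq_zero_of_flat hd (M.face_dim f)
  rw [ae_restrict_iff' (M.isCompact_cell i).measurableSet]
  filter_upwards [measure_eq_zero_iff_ae_notMem.mp h0] with x hx hxi
  rw [← hΩ.interior_closure]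
  refine interior_mono ((subset_iUnion M.cell i).trans_eq M.cell_cover) ?_
  by_contra h
  exact hx ⟨subset_closure hxi, h⟩

/-! ### The weak gradient is bounded by `h⁻¹` -/

/-- The `L²` norm of a polynomial on a cell. -/
noncomputable def cellNorm (i : Fin M.numCells) (p : Poly d) : ℝ :=
  √(∫ x in M.cell i, ev p x ^ 2)

theorem cellNorm_nonneg (i : Fin M.numCells) (p : Poly d) : 0 ≤ M.cellNorm i p :=
  Real.sqrt_nonneg _

theorem cellNorm_sq (i : Fin M.numCells) (p : Poly d) :
    M.cellNorm i p ^ 2 = ∫ x in M.cell i, ev p x ^ 2 :=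
  Real.sq_sqrt (integral_nonneg fun _ => sq_nonneg _)

/-- Pointwise, a polynomial is at most K h^(-d/2) times its L² norm, and a derivative costs one more
h⁻¹. Against a cell volume of order h^d the volume term is therefore of order h⁻¹, and against a
face area of order h^(d-1) so are the face terms. -/
theorem exists_weakPartial_le (d m : ℕ) (hd : 2 ≤ d) {ρ σ : ℝ} (N : ℕ) (hρ : 0 < ρ) (hσ : 0 < σ) :
    ∃ C > 0, ∀ (Ω : Set (Pt d)) (M : Mesh d Ω), M.IsRegular ρ σ N →
      ∀ q : Fin M.numCells → Poly d, (∀ i, (q i).totalDegree ≤ m) →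
      ∀ (i : Fin M.numCells) (b : Fin d) (t : Poly d), t.totalDegree ≤ m →
        M.size * |M.weakPartial q i b t| ≤ C * M.cellNorm i t *
          (M.cellNorm i (q i) +
            ∑ f ∈ M.facesOf i, ∑ i' ∈ M.cellsOf f, M.cellNorm i' (q i')) := by
  obtain ⟨K, hK, H⟩ := exists_inverse_inequality d m (ρ := ρ / σ ^ d) (by positivity)
  obtain ⟨ω, hω, hsurf⟩ := exists_surf_le hd
  set ω' := volume.real (closedBall (0 : Pt d) 1) with hω'
  refine ⟨(ω' + ω) * K ^ 2, by positivity, fun Ω M hM q hq i b t ht => ?_⟩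
  have hh := M.size_pos hd i
  set h := M.size with hhdef
  set s := √(h ^ d) with hsdef
  have hs : 0 < s := Real.sqrt_pos.mpr (by positivity)
  have hs2 : s * s = h ^ d := Real.mul_self_sqrt (by positivity)
  have inv : ∀ (i : Fin M.numCells) (p : Poly d), p.totalDegree ≤ m → ∀ x ∈ M.cell i,
      |ev p x| ≤ K * M.cellNorm i p / s ∧
      ∀ a, |ev (MvPolynomial.pderiv a p) x| ≤ K * M.cellNorm i p / s / h := by
    intro i p hp x hx
    -- The enclosing ball of radius `h` is centred at the evaluation point itself.
    have := H h hh x (M.cell i) (M.isCompact_cell i).measurableSet (M.cell_subset_closedBall hx)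
      (M.volume_cell_ge hσ hρ hM hd i) p hp x hx
    refine ⟨(le_div_iff₀' hs).mpr this.1, fun a => (le_div_iff₀' hh).mpr
      ((le_div_iff₀' hs).mpr (this.2 a))⟩
  obtain ⟨x₀, hx₀⟩ := M.interior_cell_nonempty i
  have hvol : volume.real (M.cell i) ≤ ω' * h ^ d :=
    volume_real_le hh.le (M.cell_subset_closedBall (interior_subset hx₀))
  have hn := M.cellNorm_nonneg
  -- the volume term
  have hA : h * |∫ x in M.cell i, ev (q i) x * ev (MvPolynomial.pderiv b t) x| ≤
      ω' * K ^ 2 * (M.cellNorm i t * M.cellNorm i (q i)) := by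
    have h1 := norm_setIntegral_le_of_norm_le_const (μ := volume) (s := M.cell i)
      (f := fun x => ev (q i) x * ev (MvPolynomial.pderiv b t) x)
      (C := (K * M.cellNorm i (q i) / s) * (K * M.cellNorm i t / s / h))
      (M.isCompact_cell i).measure_lt_top (fun x hx => by
        rw [norm_mul]
        have h3 := (inv i (q i) (hq i) x hx).1
        exact mul_le_mul h3 ((inv i t ht x hx).2 b) (abs_nonneg _) ((abs_nonneg _).trans h3))
    rw [Real.norm_eq_abs] at h1
    have h0 := hn i (q i)
    have h0' := hn i t
    calc _ ≤ h * ((K * M.cellNorm i (q i) / s) * (K * M.cellNorm i t / s / h) *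
        (ω' * h ^ d)) := by
          refine mul_le_mul_of_nonneg_left (h1.trans ?_) hh.le
          exact mul_le_mul_of_nonneg_left hvol (by positivity)
      _ = _ := by
        rw [← hs2]; field_simp
  -- the face terms
  have hB : ∀ f ∈ M.facesOf i,
      h * |∫ x in M.face f, ev (M.avg q f) x * (ev t x * M.normal i f b) ∂(surf d)| ≤
      ω * K ^ 2 * (M.cellNorm i t * ∑ i' ∈ M.cellsOf f, M.cellNorm i' (q i')) := by
    intro f hf
    rw [mem_facesOf] at hf
    have hfc := M.face_subset_cell hf
    have hcomp := (M.face_polytope f).isCompact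
    have h2 := hsurf (M.face f) h hh.le hcomp (M.face_dim f)
      fun x hx y hy => M.dist_le_size (hfc hx) (hfc hy)
    have h0' := hn i t
    have h0 : 0 ≤ ∑ i' ∈ M.cellsOf f, M.cellNorm i' (q i') :=
      Finset.sum_nonneg fun i' _ => hn i' _
    have h1 := norm_setIntegral_le_of_norm_le_const (μ := surf d) (s := M.face f)
      (f := fun x => ev (M.avg q f) x * (ev t x * M.normal i f b))
      (C := (K * (∑ i' ∈ M.cellsOf f, M.cellNorm i' (q i')) / s) * (K * M.cellNorm i t / s))
      (surf_lt_top hcomp (M.face_dim f)) (fun x hx => by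
        rw [norm_mul, norm_mul]
        refine mul_le_mul ?_ ?_ (by positivity) (by positivity)
        · refine (M.abs_ev_avg_le q f x).trans ?_
          rw [Finset.mul_sum, Finset.sum_div]
          exact Finset.sum_le_sum fun i' hi' =>
            (inv i' (q i') (hq i') x (M.face_subset_cell ((M.mem_cellsOf).mp hi') hx)).1
        · exact (mul_le_of_le_one_right (norm_nonneg _) (M.abs_normal_le hf b)).trans
            (inv i t ht x (hfc hx)).1)
    rw [Real.norm_eq_abs] at h1
    calc _ ≤ h * ((K * (∑ i' ∈ M.cellsOf f, M.cellNorm i' (q i')) / s) *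
          (K * M.cellNorm i t / s) * (ω * h ^ (d - 1))) := by
          refine mul_le_mul_of_nonneg_left (h1.trans ?_) hh.le
          exact mul_le_mul_of_nonneg_left h2 (by positivity)
      _ = (ω * K ^ 2 * (M.cellNorm i t * ∑ i' ∈ M.cellsOf f, M.cellNorm i' (q i'))) *
          (h ^ (d - 1) * h) / (s * s) := by
        field_simp
      _ = _ := by
        rw [← pow_succ, Nat.sub_add_cancel (by omega), hs2]
        field_simp
  set Q := ∑ f ∈ M.facesOf i, ∑ i' ∈ M.cellsOf f, M.cellNorm i' (q i') with hQ
  have hQ0 : 0 ≤ Q := Finset.sum_nonneg fun f _ => Finset.sum_nonneg fun i' _ => hn i' _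
  have hB' : h * |∑ f ∈ M.facesOf i, ∫ x in M.face f,
      ev (M.avg q f) x * (ev t x * M.normal i f b) ∂(surf d)| ≤
      ω * K ^ 2 * (M.cellNorm i t * Q) := by
    refine (mul_le_mul_of_nonneg_left (Finset.abs_sum_le_sum_abs _ _) hh.le).trans ?_
    rw [Finset.mul_sum, hQ, Finset.mul_sum, Finset.mul_sum]
    exact Finset.sum_le_sum hB
  have hsum : h * |M.weakPartial q i b t| ≤
      h * |∫ x in M.cell i, ev (q i) x * ev (MvPolynomial.pderiv b t) x| +
      h * |∑ f ∈ M.facesOf i, ∫ x in M.face f,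
        ev (M.avg q f) x * (ev t x * M.normal i f b) ∂(surf d)| := by
    rw [← mul_add]
    refine mul_le_mul_of_nonneg_left ((abs_add_le _ _).trans_eq ?_) hh.le
    rw [abs_neg]
  have hω'0 : 0 ≤ ω' := measureReal_nonneg
  -- These are the two cross terms that appear when (ω' + ω) times the sum of both norm
  -- contributions is expanded.
  have e1 : 0 ≤ ω * K ^ 2 * (M.cellNorm i t * M.cellNorm i (q i)) := by
    have := hn i t; have := hn i (q i); positivity
  have e2 : 0 ≤ ω' * K ^ 2 * (M.cellNorm i t * Q) := by
    have := hn i t; positivity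
  nlinarith [hsum, hA, hB', e1, e2]

/-- Sums over the neighbours of all cells are controlled by sums over the cells. -/
theorem sum_neighbours_le {N : ℕ} (hN : ∀ i, (M.facesOf i).card ≤ N) (x : Fin M.numCells → ℝ) :
    ∑ i, (x i + ∑ f ∈ M.facesOf i, ∑ i' ∈ M.cellsOf f, x i') ^ 2 ≤
      (2 + 8 * N ^ 2) * ∑ i, x i ^ 2 := by
  have h1 : ∀ i, (x i + ∑ f ∈ M.facesOf i, ∑ i' ∈ M.cellsOf f, x i') ^ 2 ≤
      2 * x i ^ 2 + 4 * N * ∑ f ∈ M.facesOf i, ∑ i' ∈ M.cellsOf f, x i' ^ 2 := by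
    intro i
    have hNi : ((M.facesOf i).card : ℝ) ≤ N := by exact_mod_cast hN i
    have h2 : (∑ f ∈ M.facesOf i, ∑ i' ∈ M.cellsOf f, x i') ^ 2 ≤
        N * (2 * ∑ f ∈ M.facesOf i, ∑ i' ∈ M.cellsOf f, x i' ^ 2) := by
      refine (sq_sum_le_card_mul_sum_sq).trans ?_
      refine mul_le_mul hNi ?_ (Finset.sum_nonneg fun _ _ => sq_nonneg _) (by positivity)
      rw [Finset.mul_sum]
      refine Finset.sum_le_sum fun f _ => (sq_sum_le_card_mul_sum_sq).trans ?_
      refine mul_le_mul_of_nonneg_right ?_ (Finset.sum_nonneg fun _ _ => sq_nonneg _)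
      exact_mod_cast M.card_cellsOf_le f
    nlinarith [sq_nonneg (x i - ∑ f ∈ M.facesOf i, ∑ i' ∈ M.cellsOf f, x i')]
  have h3 : ∑ i, ∑ f ∈ M.facesOf i, ∑ i' ∈ M.cellsOf f, x i' ^ 2 ≤
      2 * N * ∑ i, x i ^ 2 := by
    -- Double counting of incident pairs: each face has at most 2 cells and each cell at most `N`
    -- faces, whence the factor 2N.
    have e1 : ∑ i, ∑ f ∈ M.facesOf i, ∑ i' ∈ M.cellsOf f, x i' ^ 2 =
        ∑ f, ∑ i ∈ M.cellsOf f, ∑ i' ∈ M.cellsOf f, x i' ^ 2 :=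
      Finset.sum_comm' fun i f => by simp [mem_facesOf, mem_cellsOf]
    have e2 : ∑ f, ∑ i' ∈ M.cellsOf f, x i' ^ 2 = ∑ i', ∑ f ∈ M.facesOf i', x i' ^ 2 :=
      Finset.sum_comm' fun f i => by simp [mem_facesOf, mem_cellsOf]
    calc _ = ∑ f, ((M.cellsOf f).card : ℝ) * ∑ i' ∈ M.cellsOf f, x i' ^ 2 := by
          rw [e1]; simp [Finset.sum_const]
      _ ≤ ∑ f, 2 * ∑ i' ∈ M.cellsOf f, x i' ^ 2 := by
          refine Finset.sum_le_sum fun f _ => mul_le_mul_of_nonneg_right ?_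
            (Finset.sum_nonneg fun _ _ => sq_nonneg _)
          exact_mod_cast M.card_cellsOf_le f
      _ = 2 * ∑ i', ((M.facesOf i').card : ℝ) * x i' ^ 2 := by
          rw [← Finset.mul_sum, e2]; simp [Finset.sum_const]
      _ ≤ 2 * ∑ i', N * x i' ^ 2 := by
          gcongr with i'
          exact_mod_cast hN i'
      _ = _ := by rw [← Finset.mul_sum]; ring
  calc _ ≤ ∑ i, (2 * x i ^ 2 + 4 * N * ∑ f ∈ M.facesOf i, ∑ i' ∈ M.cellsOf f, x i' ^ 2) :=
        Finset.sum_le_sum fun i _ => h1 i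
    _ = 2 * ∑ i, x i ^ 2 +
        4 * N * ∑ i, ∑ f ∈ M.facesOf i, ∑ i' ∈ M.cellsOf f, x i' ^ 2 := by
        rw [Finset.sum_add_distrib, Finset.mul_sum, Finset.mul_sum]
    _ ≤ 2 * ∑ i, x i ^ 2 + 4 * N * (2 * N * ∑ i, x i ^ 2) := by gcongr
    _ = _ := by ring

theorem isWeakGrad_weakGrad (j : Fin M.numCells → ℕ) (v : Fin M.numCells → Fin d → Poly d) :
    M.IsWeakGrad j v (M.weakGrad j v) :=
  Classical.epsilon_spec (M.existsUnique_isWeakGrad j v).exists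

theorem isWeakGradScalar_weakGradScalar (k : ℕ) (q : Fin M.numCells → Poly d) :
    M.IsWeakGradScalar k q (M.weakGradScalar k q) :=
  Classical.epsilon_spec (M.existsUnique_isWeakGradScalar k q).exists

/-- The squared `L²` norm of a piecewise polynomial vector function. -/
noncomputable def normSq (v : Fin M.numCells → Fin d → Poly d) : ℝ :=
  ∑ i, ∑ a, M.cellNorm i (v i a) ^ 2

/-- Each component of the weak gradient is tested against itself. Since k < j ≤ J, both `v` and the
weak gradient have degree at most `J`, so one constant serves all cells; the neighbour sums overlap
boundedly, and `d` counts the column indices. -/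
theorem exists_weakGrad_le (d k J N : ℕ) (hd : 2 ≤ d) {ρ σ : ℝ} (hρ : 0 < ρ) (hσ : 0 < σ) :
    ∃ C > 0, ∀ (Ω : Set (Pt d)) (M : Mesh d Ω), M.IsRegular ρ σ N →
      ∀ j : Fin M.numCells → ℕ, (∀ i, k < j i ∧ j i ≤ J) → ∀ v ∈ M.VSpace k,
        M.size ^ 2 * ∑ i, ∑ a, ∑ b, M.cellNorm i (M.weakGrad j v i a b) ^ 2 ≤
          C * M.normSq v := by
  obtain ⟨C, hC, H⟩ := exists_weakPartial_le d J hd N hρ hσ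
  refine ⟨d * C ^ 2 * (2 + 8 * N ^ 2), by positivity, fun Ω M hM j hj v hv => ?_⟩
  have hn := M.cellNorm_nonneg
  have hG := (M.isWeakGrad_iff j v _).mp (M.isWeakGrad_weakGrad j v)
  have hsz : ∀ i : Fin M.numCells, 0 < M.size := M.size_pos hd
  have hcell : ∀ i a b, M.size ^ 2 * M.cellNorm i (M.weakGrad j v i a b) ^ 2 ≤ C ^ 2 *
      (M.cellNorm i (v i a) +
        ∑ f ∈ M.facesOf i, ∑ i' ∈ M.cellsOf f, M.cellNorm i' (v i' a)) ^ 2 := by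
    intro i a b
    obtain ⟨hdeg, hrep⟩ := hG i a b
    have h1 := H Ω M hM (fun i' => v i' a)
      (fun i' => (hv i' a).trans ((hj i').1.le.trans (hj i').2)) i b _ (hdeg.trans (hj i).2)
    have h2 : M.weakPartial (fun i' => v i' a) i b (M.weakGrad j v i a b) =
        M.cellNorm i (M.weakGrad j v i a b) ^ 2 := by
      rw [← hrep _ hdeg, cellNorm_sq]
      simp only [sq]
    rw [h2, abs_of_nonneg (sq_nonneg _)] at h1
    set g := M.cellNorm i (M.weakGrad j v i a b) with hg
    set Q := M.cellNorm i (v i a) +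
        ∑ f ∈ M.facesOf i, ∑ i' ∈ M.cellsOf f, M.cellNorm i' (v i' a) with hQ
    have hQ0 : 0 ≤ Q := add_nonneg (hn _ _)
      (Finset.sum_nonneg fun f _ => Finset.sum_nonneg fun i' _ => hn i' _)
    have hg0 : 0 ≤ g := hn _ _
    have hs := hsz i
    -- The tested identity gives h g² ≤ C g Q; one factor `g` is cancelled, the case g = 0 being
    -- trivial.
    have h3 : M.size * g ≤ C * Q := by
      rcases hg0.eq_or_lt with h0 | h0
      · rw [← h0, mul_zero]; positivity
      · refine le_of_mul_le_mul_right ?_ h0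
        calc _ = M.size * g ^ 2 := by ring
          _ ≤ _ := h1
          _ = _ := by ring
    rw [← mul_pow, ← mul_pow]
    exact pow_le_pow_left₀ (by positivity) h3 2
  have hcol : ∀ a b, ∑ i, M.size ^ 2 * M.cellNorm i (M.weakGrad j v i a b) ^ 2 ≤
      C ^ 2 * ((2 + 8 * N ^ 2) * ∑ i, M.cellNorm i (v i a) ^ 2) := fun a b => by
    refine (Finset.sum_le_sum fun i _ => hcell i a b).trans ?_
    rw [← Finset.mul_sum]
    exact mul_le_mul_of_nonneg_left
      (M.sum_neighbours_le hM.card_faces_le fun i => M.cellNorm i (v i a)) (sq_nonneg C)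
  calc _ = ∑ a, ∑ b, ∑ i, M.size ^ 2 * M.cellNorm i (M.weakGrad j v i a b) ^ 2 := by
        simp only [Finset.mul_sum]
        rw [Finset.sum_comm]
        exact Finset.sum_congr rfl fun a _ => Finset.sum_comm
    _ ≤ ∑ a, ∑ b : Fin d, C ^ 2 * ((2 + 8 * N ^ 2) * ∑ i, M.cellNorm i (v i a) ^ 2) :=
        Finset.sum_le_sum fun a _ => Finset.sum_le_sum fun b _ => hcol a b
    _ = _ := by
        simp only [Finset.sum_const, Finset.card_univ, Fintype.card_fin, nsmul_eq_mul]
        rw [← Finset.mul_sum, ← Finset.mul_sum, ← Finset.mul_sum, normSq, Finset.sum_comm]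
        ring

end Mesh

theorem sqrt_add_le_sqrt_add_sqrt {x y : ℝ} (hx : 0 ≤ x) (hy : 0 ≤ y) : √(x + y) ≤ √x + √y := by
  refine Real.sqrt_le_iff.mpr ⟨by positivity, ?_⟩
  rw [add_sq, Real.sq_sqrt hx, Real.sq_sqrt hy]
  linarith [mul_nonneg (Real.sqrt_nonneg x) (Real.sqrt_nonneg y)]

/-! ### The permeability tensor -/

theorem measurable_det {n : Type*} [Fintype n] [DecidableEq n] {α : Type*} [MeasurableSpace α]
    {A : α → Matrix n n ℝ} (hA : ∀ a b, Measurable fun x => A x a b) :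
    Measurable fun x => (A x).det := by
  simp only [Matrix.det_apply']
  exact Finset.measurable_sum _ fun τ _ =>
    (Finset.measurable_prod _ fun a _ => hA _ _).const_mul _

/-- Cramer's rule expresses the entries through determinants. It also covers singular matrices,
where both the matrix inverse and the inverse of the determinant are 0 by convention. -/
theorem measurable_inv_apply {n : Type*} [Fintype n] [DecidableEq n] {α : Type*}
    [MeasurableSpace α] {A : α → Matrix n n ℝ} (hA : ∀ a b, Measurable fun x => A x a b)
    (a b : n) : Measurable fun x => (A x)⁻¹ a b := by
  simp only [Matrix.inv_def, Matrix.smul_apply, Matrix.adjugate_apply, smul_eq_mul,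
    Ring.inverse_eq_inv']
  refine (measurable_det hA).inv.mul (measurable_det fun c c' => ?_)
  rcases eq_or_ne c b with rfl | hc
  · simp
  · simpa [Matrix.updateRow_ne hc] using hA c c'

namespace IsPermeability

variable {d : ℕ} {Ω : Set (Pt d)} {κ : Pt d → Matrix (Fin d) (Fin d) ℝ} {lam₁ lam₂ : ℝ}

/-- This is the lower bound for κ⁻¹ at the vector κξ. -/
theorem lower_mulVec (hκ : IsPermeability Ω κ lam₁ lam₂) {x : Pt d} (hx : x ∈ Ω)
    (ξ : Fin d → ℝ) :
    lam₁ * dotProduct ((κ x).mulVec ξ) ((κ x).mulVec ξ) ≤ dotProduct ξ ((κ x).mulVec ξ) := by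
  have h := hκ.lower x hx ((κ x).mulVec ξ)
  rwa [Matrix.mulVec_mulVec, Matrix.nonsing_inv_mul _
    ((Matrix.isUnit_iff_isUnit_det _).mp (hκ.isUnit x hx)), Matrix.one_mulVec,
    dotProduct_comm _ ξ] at h

theorem dotProduct_mulVec_nonneg (hκ : IsPermeability Ω κ lam₁ lam₂) (hlam₁ : 0 < lam₁) {x : Pt d}
    (hx : x ∈ Ω) (ξ : Fin d → ℝ) : 0 ≤ dotProduct ξ ((κ x).mulVec ξ) :=
  (mul_nonneg hlam₁.le (Finset.sum_nonneg fun _ _ => mul_self_nonneg _)).trans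
    (hκ.lower_mulVec hx ξ)

/-- Expanding |ξ - λ₁κξ|² ≥ 0 and using λ₁|κξ|² ≤ ξ·κξ gives the bound without diagonalizing κ. -/
theorem dotProduct_mulVec_le (hκ : IsPermeability Ω κ lam₁ lam₂) (hlam₁ : 0 < lam₁) {x : Pt d}
    (hx : x ∈ Ω) (ξ : Fin d → ℝ) :
    dotProduct ξ ((κ x).mulVec ξ) ≤ lam₁⁻¹ * dotProduct ξ ξ := by
  have h := hκ.lower_mulVec hx ξ
  set η := (κ x).mulVec ξ
  have h0 : 0 ≤ dotProduct (ξ - lam₁ • η) (ξ - lam₁ • η) :=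
    Finset.sum_nonneg fun _ _ => mul_self_nonneg _
  simp only [sub_dotProduct, dotProduct_sub, smul_dotProduct, dotProduct_smul, smul_eq_mul] at h0
  rw [dotProduct_comm η ξ] at h0
  rw [← div_eq_inv_mul, le_div_iff₀ hlam₁]
  nlinarith

end IsPermeability

/-! ### Bounds for the bilinear forms and the norms -/

namespace Mesh

variable {d : ℕ} {Ω : Set (Pt d)} (M : Mesh d Ω) {κ : Pt d → Matrix (Fin d) (Fin d) ℝ}
  {lam₁ lam₂ : ℝ}

theorem normSq_nonneg (v : Fin M.numCells → Fin d → Poly d) : 0 ≤ M.normSq v :=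
  Finset.sum_nonneg fun _ _ => Finset.sum_nonneg fun _ _ => sq_nonneg _

theorem integrableOn_sum_sq (v : Fin M.numCells → Fin d → Poly d) (i : Fin M.numCells) :
    IntegrableOn (fun x => ∑ a, ev (v i a) x * ev (v i a) x) (M.cell i) :=
  integrable_finsetSum _ fun _ _ => M.integrable_cell_mul i _ _

theorem integral_sum_sq (v : Fin d → Poly d) (i : Fin M.numCells) :
    ∫ x in M.cell i, ∑ a, ev (v a) x * ev (v a) x = ∑ a, M.cellNorm i (v a) ^ 2 := by
  rw [lhs_eq]
  simp only [cellNorm_sq]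
  simp only [sq]

theorem integral_inv_nonneg_le (hd : 2 ≤ d) (hΩ : IsPolytopalDomain Ω) (hlam₁ : 0 < lam₁)
    (hκ : IsPermeability Ω κ lam₁ lam₂) (v : Fin M.numCells → Fin d → Poly d) :
    lam₁ * M.normSq v ≤ ∑ i, ∫ x in M.cell i,
      dotProduct ((κ x)⁻¹.mulVec fun a => ev (v i a) x) (fun a => ev (v i a) x) ∧
    ∑ i, ∫ x in M.cell i,
      dotProduct ((κ x)⁻¹.mulVec fun a => ev (v i a) x) (fun a => ev (v i a) x) ≤
      lam₂ * M.normSq v := by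
  have key : ∀ i, lam₁ * ∑ a, M.cellNorm i (v i a) ^ 2 ≤ ∫ x in M.cell i,
      dotProduct ((κ x)⁻¹.mulVec fun a => ev (v i a) x) (fun a => ev (v i a) x) ∧
      ∫ x in M.cell i,
      dotProduct ((κ x)⁻¹.mulVec fun a => ev (v i a) x) (fun a => ev (v i a) x) ≤
      lam₂ * ∑ a, M.cellNorm i (v i a) ^ 2 := by
    intro i
    have hae := M.ae_mem_domain hd hΩ i
    have hlow : ∀ᵐ x ∂volume.restrict (M.cell i),
        lam₁ * ∑ a, ev (v i a) x * ev (v i a) x ≤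
        dotProduct ((κ x)⁻¹.mulVec fun a => ev (v i a) x) (fun a => ev (v i a) x) := by
      filter_upwards [hae] with x hx
      rw [dotProduct_comm]
      exact hκ.lower x hx _
    have hupp : ∀ᵐ x ∂volume.restrict (M.cell i),
        dotProduct ((κ x)⁻¹.mulVec fun a => ev (v i a) x) (fun a => ev (v i a) x) ≤
        lam₂ * ∑ a, ev (v i a) x * ev (v i a) x := by
      filter_upwards [hae] with x hx
      rw [dotProduct_comm]
      exact hκ.upper x hx _
    have hnn : ∀ᵐ x ∂volume.restrict (M.cell i),
        0 ≤ dotProduct ((κ x)⁻¹.mulVec fun a => ev (v i a) x) (fun a => ev (v i a) x) := by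
      filter_upwards [hlow] with x hx
      exact (mul_nonneg hlam₁.le (Finset.sum_nonneg fun _ _ => mul_self_nonneg _)).trans hx
    have hg := (M.integrableOn_sum_sq v i).const_mul lam₂
    -- Integrability is needed for the lower bound, since the integral of a non-integrable function
    -- is 0 by convention.
    have hf : Integrable (fun x => dotProduct ((κ x)⁻¹.mulVec fun a => ev (v i a) x)
        (fun a => ev (v i a) x)) (volume.restrict (M.cell i)) := by
      refine hg.mono' (Measurable.aestronglyMeasurable ?_) ?_
      · unfold dotProduct Matrix.mulVec dotProduct
        exact Finset.measurable_sum _ fun a _ => (Finset.measurable_sum _ fun b _ =>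
          (measurable_inv_apply hκ.measurable a b).mul (continuous_ev _).measurable).mul
          (continuous_ev _).measurable
      · filter_upwards [hupp, hnn] with x hx hx0
        rwa [Real.norm_eq_abs, abs_of_nonneg hx0]
    constructor
    · rw [← integral_sum_sq, ← integral_const_mul]
      exact integral_mono_ae ((M.integrableOn_sum_sq v i).const_mul lam₁) hf hlow
    · rw [← integral_sum_sq, ← integral_const_mul]
      exact integral_mono_ae hf hg hupp
  unfold normSq
  rw [Finset.mul_sum, Finset.mul_sum]
  exact ⟨Finset.sum_le_sum fun i _ => (key i).1, Finset.sum_le_sum fun i _ => (key i).2⟩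

theorem integral_mulVec_le (hd : 2 ≤ d) (hΩ : IsPolytopalDomain Ω) (hlam₁ : 0 < lam₁)
    (hκ : IsPermeability Ω κ lam₁ lam₂) (v : Fin M.numCells → Fin d → Poly d) :
    ∑ i, ∫ x in M.cell i, dotProduct (fun a => ev (v i a) x)
      ((κ x).mulVec fun a => ev (v i a) x) ≤ lam₁⁻¹ * M.normSq v := by
  unfold normSq
  rw [Finset.mul_sum]
  refine Finset.sum_le_sum fun i _ => ?_
  rw [← integral_sum_sq, ← integral_const_mul]
  have hae := M.ae_mem_domain hd hΩ i
  refine integral_mono_of_nonneg ?_ ((M.integrableOn_sum_sq v i).const_mul _) ?_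
  · filter_upwards [hae] with x hx
    exact hκ.dotProduct_mulVec_nonneg hlam₁ hx _
  · filter_upwards [hae] with x hx
    exact hκ.dotProduct_mulVec_le hlam₁ hx _

theorem integral_weakGrad_sq (j : Fin M.numCells → ℕ) (v : Fin M.numCells → Fin d → Poly d) :
    ∑ i, ∫ x in M.cell i, ∑ a, ∑ b, ev (M.weakGrad j v i a b) x * ev (M.weakGrad j v i a b) x =
      ∑ i, ∑ a, ∑ b, M.cellNorm i (M.weakGrad j v i a b) ^ 2 := by
  refine Finset.sum_congr rfl fun i _ => ?_
  rw [lhs_matrix_eq]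
  simp only [cellNorm_sq]
  simp only [sq]

/-- The gradient part is dropped. This control of the L² norm makes the supremum finite and |||g|||
positive for the test function. -/
theorem le_aForm (hd : 2 ≤ d) (hΩ : IsPolytopalDomain Ω) (hlam₁ : 0 < lam₁)
    (hκ : IsPermeability Ω κ lam₁ lam₂) (j : Fin M.numCells → ℕ)
    (v : Fin M.numCells → Fin d → Poly d) : lam₁ * M.normSq v ≤ M.aForm κ j v v := by
  unfold aForm
  rw [integral_weakGrad_sq]
  refine le_add_of_nonneg_of_le ?_ (M.integral_inv_nonneg_le hd hΩ hlam₁ hκ v).1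
  exact Finset.sum_nonneg fun _ _ => Finset.sum_nonneg fun _ _ => Finset.sum_nonneg fun _ _ =>
    sq_nonneg _

theorem bForm_self (k : ℕ) (q : Fin M.numCells → Poly d) :
    M.bForm k (M.weakGradScalar k q) q = M.normSq (M.weakGradScalar k q) := by
  unfold bForm normSq
  exact Finset.sum_congr rfl fun i _ => M.integral_sum_sq _ i

/-- A weighted Young inequality for `b`. -/
theorem abs_bForm_le (k : ℕ) (v : Fin M.numCells → Fin d → Poly d) (q : Fin M.numCells → Poly d)
    {s : ℝ} (hs : 0 < s) :
    |M.bForm k v q| ≤ s * M.normSq v + s⁻¹ * M.normSq (M.weakGradScalar k q) := by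
  unfold bForm normSq
  rw [Finset.mul_sum, Finset.mul_sum, ← Finset.sum_add_distrib]
  refine (Finset.abs_sum_le_sum_abs _ _).trans (Finset.sum_le_sum fun i _ => ?_)
  set g := M.weakGradScalar k q
  have h1 := (M.integrableOn_sum_sq v i).const_mul s
  have h2 := (M.integrableOn_sum_sq g i).const_mul s⁻¹
  rw [← integral_sum_sq, ← integral_sum_sq, ← integral_const_mul, ← integral_const_mul,
    ← integral_add h1 h2, ← Real.norm_eq_abs]
  refine norm_integral_le_of_norm_le (h1.add h2) (Filter.Eventually.of_forall fun x => ?_)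
  simp only [Real.norm_eq_abs, Finset.mul_sum, ← Finset.sum_add_distrib]
  refine (Finset.abs_sum_le_sum_abs _ _).trans (Finset.sum_le_sum fun a _ => ?_)
  set y := ev (v i a) x
  set z := ev (g i a) x
  have e : s * (y * y) + s⁻¹ * (z * z) = s⁻¹ * ((s * y) ^ 2 + z ^ 2) := by field_simp
  have e' : |y * z| = s⁻¹ * |s * y * z| := by
    rw [mul_assoc, abs_mul s, abs_of_pos hs, inv_mul_cancel_left₀ hs.ne']
  rw [e, e']
  refine mul_le_mul_of_nonneg_left ?_ (by positivity)
  rw [abs_mul, ← sq_abs (s * y), ← sq_abs z]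
  nlinarith [sq_nonneg (|s * y| - |z|), sq_nonneg (|s * y|), sq_nonneg (|z|)]

/-- Young's inequality with weight s = |||v|||⁻¹ and λ₁‖v‖² ≤ |||v|||² bound |b(v, q)| by a multiple
of |||v||| independent of `v`. The bound is not sharp and serves only to show finiteness. -/
theorem bForm_div_triNorm_le (hd : 2 ≤ d) (hΩ : IsPolytopalDomain Ω) (hlam₁ : 0 < lam₁)
    (hκ : IsPermeability Ω κ lam₁ lam₂) (j : Fin M.numCells → ℕ) (k : ℕ)
    (v : Fin M.numCells → Fin d → Poly d) (q : Fin M.numCells → Poly d) :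
    |M.bForm k v q| / M.triNorm κ j v ≤ lam₁⁻¹ + M.normSq (M.weakGradScalar k q) := by
  have hG := M.normSq_nonneg (M.weakGradScalar k q)
  have hV := M.normSq_nonneg v
  have ha := M.le_aForm hd hΩ hlam₁ hκ j v
  have ha0 : 0 ≤ M.aForm κ j v v := (mul_nonneg hlam₁.le hV).trans ha
  refine div_le_of_le_mul₀ (Real.sqrt_nonneg _) (by positivity) ?_
  rcases (Real.sqrt_nonneg (M.aForm κ j v v)).eq_or_lt with h0 | h0
  · have h1 : M.normSq v = 0 := by
      have : M.aForm κ j v v = 0 := (Real.sqrt_eq_zero ha0).mp h0.symm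
      nlinarith
    have h2 : |M.bForm k v q| ≤ 0 := by
      -- When |||v||| = 0 also ‖v‖ = 0, and a large Young weight makes the remaining term at most ε.
      refine le_of_forall_pos_le_add fun ε hε => ?_
      have := M.abs_bForm_le k v q
        (s := (M.normSq (M.weakGradScalar k q) + 1) / ε) (by positivity)
      rw [h1, mul_zero, zero_add, inv_div, div_mul_eq_mul_div] at this
      rw [zero_add]
      refine this.trans ((div_le_iff₀ (by positivity)).mpr ?_)
      nlinarith
    exact h2.trans (mul_nonneg (by positivity) (Real.sqrt_nonneg _))
  · change 0 < M.triNorm κ j v at h0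
    have h1 := M.abs_bForm_le k v q (s := (M.triNorm κ j v)⁻¹) (by positivity)
    have h2 : M.triNorm κ j v ^ 2 = M.aForm κ j v v := Real.sq_sqrt ha0
    have h3 : M.normSq v ≤ lam₁⁻¹ * M.triNorm κ j v ^ 2 := by
      rw [h2, ← div_eq_inv_mul, le_div_iff₀ hlam₁]; linarith
    refine h1.trans ?_
    have h4 : (M.triNorm κ j v)⁻¹ * M.normSq v ≤ lam₁⁻¹ * M.triNorm κ j v := by
      calc _ ≤ (M.triNorm κ j v)⁻¹ * (lam₁⁻¹ * M.triNorm κ j v ^ 2) := by gcongr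
        _ = _ := by field_simp
    rw [inv_inv, add_mul, mul_comm (M.normSq _)]
    exact add_le_add_left h4 _

/-- Since h² h⁻¹ = h, the jump part of |||q|||₁ times `h` is ‖q‖_h, whatever the set of faces; this
settles both choices of faces at once. -/
theorem size_mul_triNormOne_le (hd : 2 ≤ d) (hΩ : IsPolytopalDomain Ω) (hlam₁ : 0 < lam₁)
    (hκ : IsPermeability Ω κ lam₁ lam₂) (k : ℕ) (S : Finset (Fin M.numFaces))
    (q : Fin M.numCells → Poly d) :
    M.size * M.triNormOne κ k S q ≤
      M.size * √(lam₁⁻¹ * M.normSq (M.weakGradScalar k q)) + M.hNorm S q := by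
  obtain ⟨i⟩ := M.nonempty_cells hΩ
  have hs := M.size_pos hd i
  have hh : M.hNorm S q =
      M.size * √(∑ f ∈ S, M.size⁻¹ * ∫ x in M.face f, ‖M.jump q f x‖ ^ 2 ∂(surf d)) := by
    unfold hNorm
    rw [← Real.sqrt_sq hs.le, ← Real.sqrt_mul (sq_nonneg _), Finset.mul_sum, Real.sqrt_sq hs.le]
    congr 1
    refine Finset.sum_congr rfl fun f _ => ?_
    field_simp
  rw [hh, ← mul_add]
  refine mul_le_mul_of_nonneg_left ((Real.sqrt_le_sqrt (add_le_add_left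
    (M.integral_mulVec_le hd hΩ hlam₁ hκ _) _)).trans ?_) hs.le
  exact sqrt_add_le_sqrt_add_sqrt
    (mul_nonneg (inv_nonneg.mpr hlam₁.le) (M.normSq_nonneg _))
    (Finset.sum_nonneg fun f _ => mul_nonneg (inv_nonneg.mpr hs.le)
      (integral_nonneg fun _ => sq_nonneg _))

/-- The gradient part costs h⁻²; the zero-order part has no such loss, and its factor h² is absorbed
by the squared diameter of Ω. -/
theorem exists_aForm_le (hd : 2 ≤ d) (hΩ : IsPolytopalDomain Ω) (k J N : ℕ) {ρ σ : ℝ}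
    (hρ : 0 < ρ) (hσ : 0 < σ) (hlam₁ : 0 < lam₁) (hlam₂ : 0 < lam₂) :
    ∃ C > 0, ∀ M : Mesh d Ω, M.IsRegular ρ σ N →
      ∀ j : Fin M.numCells → ℕ, (∀ i, k < j i ∧ j i ≤ J) →
      ∀ κ, IsPermeability Ω κ lam₁ lam₂ → ∀ v ∈ M.VSpace k,
        M.size ^ 2 * M.aForm κ j v v ≤ C * M.normSq v := by
  obtain ⟨C, hC, H⟩ := exists_weakGrad_le d k J N hd hρ hσ
  refine ⟨C + diam (closure Ω) ^ 2 * lam₂, by positivity, fun M hM j hj κ hκ v hv => ?_⟩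
  obtain ⟨i⟩ := M.nonempty_cells hΩ
  have hs := M.size_pos hd i
  have h1 := H Ω M hM j hj v hv
  have h2 := (M.integral_inv_nonneg_le hd hΩ hlam₁ hκ v).2
  unfold aForm
  rw [integral_weakGrad_sq, mul_add, add_mul, mul_assoc]
  refine add_le_add h1 (mul_le_mul (pow_le_pow_left₀ hs.le (M.size_le_diam hΩ) 2) h2
    ?_ (by positivity))
  exact (mul_nonneg hlam₁.le (M.normSq_nonneg v)).trans
    (M.integral_inv_nonneg_le hd hΩ hlam₁ hκ v).1

end Mesh

end CDG

/-! ### The inf-sup estimate -/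

theorem mainTheorem4 (d : ℕ) (hd : 2 ≤ d) (Ω : Set (CDG.Pt d)) (hΩ : CDG.IsPolytopalDomain Ω)
    (k J N : ℕ) (hk : 1 ≤ k) (lam₁ lam₂ ρ σ : ℝ) (hlam₁ : 0 < lam₁) (hlam₂ : 0 < lam₂)
    (hρ : 0 < ρ) (hσ : 0 < σ) :
    ∃ C₁ C₂ : ℝ, 0 < C₁ ∧ 0 < C₂ ∧
      ∀ M : CDG.Mesh d Ω, M.IsRegular ρ σ N →
      ∀ j : Fin M.numCells → ℕ, (∀ i, k < j i ∧ j i ≤ J) →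
      ∀ κ : CDG.Pt d → Matrix (Fin d) (Fin d) ℝ, CDG.IsPermeability Ω κ lam₁ lam₂ →
      ∀ S : Finset (Fin M.numFaces), S = Finset.univ ∨ S = M.interiorFaces →
      ∀ q ∈ M.WSpace k,
        BddAbove (Set.range fun v : {v // v ∈ M.VSpace k ∧ v ≠ 0} =>
          |M.bForm k v.1 q| / M.triNorm κ j v.1) ∧
        C₁ * M.size * M.triNormOne κ k S q - C₂ * M.hNorm S q ≤
          ⨆ v : {v // v ∈ M.VSpace k ∧ v ≠ 0}, |M.bForm k v.1 q| / M.triNorm κ j v.1 := by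
  obtain ⟨C, hC, H⟩ := CDG.Mesh.exists_aForm_le hd hΩ k J N hρ hσ hlam₁ hlam₂
  have hC₁ : 0 < √lam₁ / √C := div_pos (Real.sqrt_pos.mpr hlam₁) (Real.sqrt_pos.mpr hC)
  -- This factor turns λ₁^(-1/2) h ‖g‖ into h ‖g‖ / √C, the value reached by the test function; the
  -- jump term is multiplied by the same factor.
  refine ⟨√lam₁ / √C, √lam₁ / √C, hC₁, hC₁, fun M hM j hj κ hκ S _ q _ => ?_⟩
  have hbdd : BddAbove (Set.range fun v : {v // v ∈ M.VSpace k ∧ v ≠ 0} =>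
      |M.bForm k v.1 q| / M.triNorm κ j v.1) := by
    refine ⟨lam₁⁻¹ + M.normSq (M.weakGradScalar k q), ?_⟩
    rintro _ ⟨v, rfl⟩
    exact M.bForm_div_triNorm_le hd hΩ hlam₁ hκ j k v.1 q
  refine ⟨hbdd, ?_⟩
  set g := M.weakGradScalar k q with hg
  have hgV : g ∈ M.VSpace k := fun i => (M.isWeakGradScalar_weakGradScalar k q i).1
  obtain ⟨i⟩ := M.nonempty_cells hΩ
  have hs := M.size_pos hd i
  have hlower : √lam₁ / √C * M.size * M.triNormOne κ k S q - √lam₁ / √C * M.hNorm S q ≤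
      M.size * √(M.normSq g) / √C := by
    have h1 := mul_le_mul_of_nonneg_left (M.size_mul_triNormOne_le hd hΩ hlam₁ hκ k S q) hC₁.le
    rw [Real.sqrt_mul (by positivity), Real.sqrt_inv] at h1
    have h2 : √lam₁ / √C * (M.size * ((√lam₁)⁻¹ * √(M.normSq g)) + M.hNorm S q) =
        M.size * √(M.normSq g) / √C + √lam₁ / √C * M.hNorm S q := by
      have := Real.sqrt_pos.mpr hlam₁
      field_simp
    rw [h2] at h1
    linarith
  refine hlower.trans ?_
  -- If ‖g‖ = 0 there is no admissible test function `g`, but the lower bound is then 0 and the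
  -- quotients are nonnegative.
  rcases (M.normSq_nonneg g).eq_or_lt with h0 | h0
  · rw [← h0, Real.sqrt_zero, mul_zero, zero_div]
    exact Real.iSup_nonneg fun v => div_nonneg (abs_nonneg _) (Real.sqrt_nonneg _)
  · have hg0 : g ≠ 0 := by
      intro h
      rw [h] at h0
      simp [CDG.Mesh.normSq, CDG.Mesh.cellNorm, CDG.ev] at h0
    refine le_trans ?_ (le_ciSup hbdd ⟨g, hgV, hg0⟩)
    have ha := M.le_aForm hd hΩ hlam₁ hκ j g
    have hpos : 0 < M.triNorm κ j g := Real.sqrt_pos.mpr (by nlinarith [mul_pos hlam₁ h0])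
    have hupper : M.size * M.triNorm κ j g ≤ √C * √(M.normSq g) := by
      rw [← Real.sqrt_mul hC.le, ← Real.sqrt_sq hs.le, CDG.Mesh.triNorm,
        ← Real.sqrt_mul (sq_nonneg _)]
      exact Real.sqrt_le_sqrt (H M hM j hj κ hκ g hgV)
    change _ ≤ |M.bForm k g q| / M.triNorm κ j g
    rw [hg, M.bForm_self, ← hg, abs_of_pos h0, div_le_div_iff₀ (Real.sqrt_pos.mpr hC) hpos]
    calc _ = √(M.normSq g) * (M.size * M.triNorm κ j g) := by ring
      _ ≤ √(M.normSq g) * (√C * √(M.normSq g)) := by gcongr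
      _ = (√(M.normSq g) * √(M.normSq g)) * √C := by ring
      _ = _ := by rw [Real.mul_self_sqrt h0.le]
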